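/- Let $\theta\in(0,1]$, let $\lambda_t\ge 0$ ($t\ge0$) be measurable with $\Lambda_t=\int_0^t\lambda_u\,du<\infty$ for all $t$, and let $a_t$ be measurable with $0\le a_t\le 1+1/\theta$ for all $t\ge 0$. Let $\{Z_t\}_{t\ge0}$, $Z_0=1$, be the theta-positive branching process in the varying environment $(\{\lambda_t\},\{a_t\})$, that is, the time inhomogeneous Markov branching process (with right-continuous paths having left limits) in which every individual alive at time $t$ dies at rate $\lambda_t$, independently of the others, and is then replaced by $k$ individuals with probability $p_t(k)$, where $p_t(0)=1-\frac{\theta}{1+\theta}a_t$, $p_t(1)=0$ and $p_t(n)=\frac{1}{n!}\,\theta(1-\theta)(2-\theta)\cdots(n-2-\theta)\,a_t$ for $n\ge2$ (equivalently, $\sum_k p_t(k)s^k=1-a_t(1-s)+\frac{a_t}{1+\theta}(1-s)^{1+\theta}$ for $0\le s\le1$). Put $\mu_t=\mathrm{E}(Z_t)$, $q=\lim_{t\to\infty}\mathrm{P}(Z_t=0)$, $\Lambda=\lim_{t\to\infty}\Lambda_t$, and $$V_{t,\theta}=\frac{\theta}{1+\theta}\int_0^t\mu_u^{-\theta}\,d\Lambda_u,\qquad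 V_\theta=\lim_{t\to\infty}V_{t,\theta}.$$ The process is called asymptotically degenerate if $q<1$ and $\liminf_{t\to\infty}\mu_t<\infty$. Theorem. The theta-positive branching process is asymptotically degenerate if and only if $\Lambda<\infty$. In this case, $V_\theta<\infty$, $\lim_{t\to\infty}\mu_t=\mu$ with $0<\mu<\infty$, and $Z_t$ converges almost surely, as $t\to\infty$, to a random variable $Z_\infty$ with values in $\{0,1,2,\dots\}$ such that, for $0\le s<1$, $$\mathrm{E}(s^{Z_\infty})=1-\Big(V_\theta+(1+\theta)^{-1}(1-\mu^{-\theta})+\mu^{-\theta}(1-s)^{-\theta}\Big)^{-1/\theta}.$$ -/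

import Mathlib

open MeasureTheory ProbabilityTheory Filter Topology Set
open scoped NNReal ENNReal

namespace VaryingBranching

/-- The offspring number generating function `h(s) = 1 - a(1-s) + a(1+θ)⁻¹(1-s)^{1+θ}`
of the theta-positive family, with mean offspring number `a`. -/
noncomputable def thetaPGF (θ a s : ℝ) : ℝ :=
  1 - a * (1 - s) + a * (1 + θ)⁻¹ * (1 - s) ^ (1 + θ)

/-- The probability of `k` offspring in the theta-positive family:
`p(0) = 1 - θ(1+θ)⁻¹a`, `p(1) = 0`, and
`p(n) = θ(1-θ)(2-θ)⋯(n-2-θ) a / n!` for `n ≥ 2`. -/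
noncomputable def thetaLaw (θ a : ℝ) : ℕ → ℝ
  | 0 => 1 - θ * (1 + θ)⁻¹ * a
  | 1 => 0
  | n + 2 => ((n + 2).factorial : ℝ)⁻¹ * (θ * ∏ j ∈ Finset.range n, ((j : ℝ) + 1 - θ)) * a

theorem thetaLaw_nonneg {θ a : ℝ} (h0 : 0 < θ) (h1 : θ ≤ 1) (ha : 0 ≤ a)
    (ha' : a ≤ 1 + 1 / θ) (k : ℕ) : 0 ≤ thetaLaw θ a k := by
  match k with
  | 0 =>
    have h : θ * (1 + θ)⁻¹ * a ≤ θ * (1 + θ)⁻¹ * (1 + 1 / θ) := by gcongr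
    have h' : θ * (1 + θ)⁻¹ * (1 + 1 / θ) = 1 := by field_simp; ring
    simp only [thetaLaw]; linarith
  | 1 => simp [thetaLaw]
  | n + 2 =>
    simp only [thetaLaw]
    have : 0 ≤ ∏ j ∈ Finset.range n, ((j : ℝ) + 1 - θ) :=
      Finset.prod_nonneg fun j _ => by
        have : (0 : ℝ) ≤ j := Nat.cast_nonneg j
        linarith
    positivity

theorem thetaLaw_hasSum_aux {θ a s : ℝ} (h0 : 0 < θ) (hs : |s| < 1) :
    HasSum (fun k => thetaLaw θ a k * s ^ k) (thetaPGF θ a s) := by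
  have hb := (Real.one_add_rpow_hasFPowerSeriesOnBall_zero (a := 1 + θ)).hasSum
    (y := -s) (by simpa [enorm_eq_nnnorm] using! hs)
  simp only [binomialSeries_apply, zero_add, List.ofFn_const, List.prod_replicate,
    smul_eq_mul] at hb
  have hb2 := hb.mul_left (a * (1 + θ)⁻¹)
  have hc : HasSum (fun k : ℕ => if k = 0 then 1 - a else if k = 1 then a * s else 0)
      (1 - a + a * s) := by
    have := hasSum_sum_of_ne_finset_zero (L := SummationFilter.unconditional ℕ) (s := Finset.range 2)
      (f := fun k : ℕ => if k = 0 then 1 - a else if k = 1 then a * s else 0)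
      (fun b hb => by
        have : 1 < b := by simpa using hb
        rw [if_neg (by lia), if_neg (by lia)])
    simpa [Finset.sum_range_succ] using this
  convert hc.add hb2 using 1
  · funext k
    have hθ : (1 + θ) ≠ 0 := by positivity
    have hdp : ∀ m : ℕ, (descPochhammer ℤ m).smeval (1 + θ)
        = ∏ j ∈ Finset.range m, (1 + θ - (j : ℝ)) := fun m => by
      rw [← Polynomial.aeval_eq_smeval, Polynomial.aeval_def, Polynomial.eval₂_eq_eval_map,
        descPochhammer_map, descPochhammer_eval_eq_prod_range]
    rw [Ring.choose_eq_smul, hdp]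
    match k with
    | 0 => simp [thetaLaw]; field_simp; ring
    | 1 => simp [thetaLaw]; field_simp; ring
    | n + 2 =>
      simp only [thetaLaw, smul_eq_mul]
      rw [Finset.prod_range_succ', Finset.prod_range_succ', if_neg (by lia), if_neg (by lia)]
      have : ∏ j ∈ Finset.range n, (1 + θ - ((j + 1 + 1 : ℕ) : ℝ))
          = (-1) ^ n * ∏ j ∈ Finset.range n, ((j : ℝ) + 1 - θ) := by
        rw [← Finset.card_range n, ← Finset.prod_const, Finset.card_range,
          ← Finset.prod_mul_distrib]
        refine Finset.prod_congr rfl fun j _ => ?_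
        push_cast; ring
      rw [this, neg_pow s]
      have hsq : ((-1 : ℝ) ^ n) * (-1) ^ n = 1 := by rw [← mul_pow]; simp
      field_simp
      push_cast
      linear_combination (-(θ * a * s ^ (n + 2) * (∏ j ∈ Finset.range n, ((j : ℝ) + 1 - θ)) * (1 + θ))) * hsq
  · simp only [thetaPGF, sub_eq_add_neg]; ring

/-- The numbers `thetaLaw θ a k` form a probability distribution on `ℕ` whose probability
generating function is `thetaPGF θ a`. -/
theorem thetaLaw_hasSum {θ a s : ℝ} (h0 : 0 < θ) (h1 : θ ≤ 1) (ha : 0 ≤ a)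
    (ha' : a ≤ 1 + 1 / θ) (hs : 0 ≤ s) (hs' : s ≤ 1) :
    HasSum (fun k => thetaLaw θ a k * s ^ k) (thetaPGF θ a s) := by
  rcases hs'.lt_or_eq with h | rfl
  · exact thetaLaw_hasSum_aux h0 (by rwa [abs_of_nonneg hs])
  have hnn := thetaLaw_nonneg h0 h1 ha ha'
  have hcont : Continuous (thetaPGF θ a) := by
    unfold thetaPGF
    exact ((continuous_const.sub (by fun_prop))).add
      (continuous_const.mul ((by fun_prop : Continuous fun s : ℝ => 1 - s).rpow_const
        fun _ => Or.inr (by linarith)))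
  have hlim : Tendsto (thetaPGF θ a) (𝓝[<] 1) (𝓝 (thetaPGF θ a 1)) :=
    (hcont.tendsto 1).mono_left nhdsWithin_le_nhds
  have hev : ∀ᶠ x : ℝ in 𝓝[<] 1, 0 ≤ x ∧ |x| < 1 := by
    filter_upwards [Ioo_mem_nhdsLT (show (0 : ℝ) < 1 by norm_num)] with x hx
    exact ⟨hx.1.le, by rw [abs_of_pos hx.1]; exact hx.2⟩
  have hsum : Summable (thetaLaw θ a) := by
    refine summable_of_sum_range_le (c := thetaPGF θ a 1) hnn fun n => ?_
    have hpoly : Tendsto (fun x : ℝ => ∑ i ∈ Finset.range n, thetaLaw θ a i * x ^ i) (𝓝[<] 1)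
        (𝓝 (∑ i ∈ Finset.range n, thetaLaw θ a i * 1 ^ i)) :=
      ((by fun_prop : Continuous fun x : ℝ =>
        ∑ i ∈ Finset.range n, thetaLaw θ a i * x ^ i).tendsto 1).mono_left nhdsWithin_le_nhds
    simp only [one_pow, mul_one] at hpoly
    refine le_of_tendsto_of_tendsto hpoly hlim ?_
    filter_upwards [hev] with x hx
    exact sum_le_hasSum _ (fun i _ => mul_nonneg (hnn i) (pow_nonneg hx.1 i))
      (thetaLaw_hasSum_aux h0 hx.2)
  have habel := Real.tendsto_tsum_powerSeries_nhdsWithin_lt hsum.hasSum.tendsto_sum_nat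
  have heq : ∑' k, thetaLaw θ a k = thetaPGF θ a 1 := by
    refine tendsto_nhds_unique habel (hlim.congr' ?_)
    filter_upwards [hev] with x hx
    exact (thetaLaw_hasSum_aux h0 hx.2).tsum_eq.symm
  simpa [← heq] using hsum.hasSum

/-- The generator at a given time of a branching population with individual death rate `r` and
offspring law `p`: in a population of size `n` a death occurs at rate `n * r`, and with
probability `p k` the dying individual is replaced by `k` new ones, so that the size becomes
`n - 1 + k`. -/
noncomputable def generator (r : ℝ) (p : ℕ → ℝ) (f : ℕ → ℝ) (n : ℕ) : ℝ :=
  (n : ℝ) * r * ((∑' k, p k * f (n - 1 + k)) - f n)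

variable {Ω : Type*} [MeasurableSpace Ω]

/-- `Z` is a time inhomogeneous Markov branching process, started from one individual, with death
rate `lam t` and offspring law `p t` at time `t`: the process has right-continuous paths with left
limits in the discrete space `ℕ` and solves the martingale problem of the time dependent
generator `generator (lam t) (p t)` on the finitely supported functions. -/
structure IsBranchingProcess (P : Measure Ω) (lam : ℝ → ℝ) (p : ℝ → ℕ → ℝ)
    (Z : ℝ≥0 → Ω → ℕ) : Prop where
  stronglyMeasurable : ∀ t, StronglyMeasurable (Z t)
  right_continuous : ∀ ω t, ContinuousWithinAt (fun u => Z u ω) (Ici t) t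
  left_limits : ∀ ω t, ∃ n, Tendsto (fun u => Z u ω) (𝓝[<] t) (𝓝 n)
  initial : ∀ᵐ ω ∂P, Z 0 ω = 1
  martingale : ∀ f : ℕ → ℝ, f.support.Finite →
    Martingale
      (fun (t : ℝ≥0) ω => f (Z t ω) -
        ∫ u in (0 : ℝ)..t, generator (lam u) (p u) f (Z u.toNNReal ω))
      (Filtration.natural Z stronglyMeasurable) P

/-- `(lam, a)` is a varying environment admissible for the branching parameter `θ`: the death
rates are non-negative with finite cumulative hazard on bounded time intervals, and the mean
offspring numbers satisfy `0 ≤ a t ≤ 1 + 1/θ`. -/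
structure IsThetaEnvironment (θ : ℝ) (lam a : ℝ → ℝ) : Prop where
  measurable_rate : Measurable lam
  rate_nonneg : ∀ t, 0 ≤ t → 0 ≤ lam t
  integrable_rate : ∀ t, 0 ≤ t → IntegrableOn lam (Ioc 0 t)
  measurable_mean : Measurable a
  mean_nonneg : ∀ t, 0 ≤ t → 0 ≤ a t
  mean_le : ∀ t, 0 ≤ t → a t ≤ 1 + 1 / θ

/-- `Z` is a theta-positive branching process with branching parameter `θ` in the varying
environment `(lam, a)`. -/
structure IsThetaPositive (P : Measure Ω) (θ : ℝ) (lam a : ℝ → ℝ) (Z : ℝ≥0 → Ω → ℕ) :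
    Prop where
  parameter_pos : 0 < θ
  parameter_le_one : θ ≤ 1
  environment : IsThetaEnvironment θ lam a
  branching : IsBranchingProcess P lam (fun t => thetaLaw θ (a t)) Z

/-- The cumulative hazard function `Λ_t = ∫₀ᵗ λ_u du`. -/
noncomputable def cumHazard (lam : ℝ → ℝ) (t : ℝ≥0) : ℝ :=
  ∫ u in (0 : ℝ)..t, lam u

/-- The mean population size `μ_t = E(Z_t)`, as an element of `[0, ∞]`. -/
noncomputable def meanSize (P : Measure Ω) (Z : ℝ≥0 → Ω → ℕ) (t : ℝ≥0) : ℝ≥0∞ :=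
  ∫⁻ ω, (Z t ω : ℝ≥0∞) ∂P

/-- `V_{t,θ} = θ(1+θ)⁻¹ ∫₀ᵗ μ_u^{-θ} dΛ_u`, as an element of `[0, ∞]`. -/
noncomputable def thetaV (P : Measure Ω) (θ : ℝ) (lam : ℝ → ℝ) (Z : ℝ≥0 → Ω → ℕ)
    (t : ℝ≥0) : ℝ≥0∞ :=
  ENNReal.ofReal (θ * (1 + θ)⁻¹) *
    ∫⁻ u in Ioc (0 : ℝ) t, (meanSize P Z u.toNNReal) ^ (-θ) * ENNReal.ofReal (lam u)

/-- The process is asymptotically degenerate: the extinction probability `q = lim P(Z_t = 0)`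
is less than one and `liminf μ_t < ∞`. -/
def IsAsymptoticallyDegenerate (P : Measure Ω) (Z : ℝ≥0 → Ω → ℕ) : Prop :=
  (∃ q : ℝ≥0∞, Tendsto (fun t => P {ω | Z t ω = 0}) atTop (𝓝 q) ∧ q < 1) ∧
    liminf (meanSize P Z) atTop < ∞

end VaryingBranching

/-! ### Jump rates into a fixed state, and joint measurability of the paths -/

namespace VaryingBranching

/-! Everything rests on an explicit generating function. Let `E` be `logMean`, `w = exp (-θ E)`
(`meanWeight`) and `B` the integral of `θ(1+θ)⁻¹ λ a w` (`bernoulliTerm`). Then `E(s^{Z_T}) = 1 -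
(B_T + w_T (1-s)^{-θ})^{-1/θ}`, which is `integral_pow`.

The formula comes from duality between the forward and backward equations. The martingale problem,
tested on indicators of single states, gives the forward equation for the state probabilities. The
backward equation for `x = 1 - ` generating function is of Bernoulli type, `x' = λ((1-a)x +
a(1+θ)⁻¹x^{1+θ})`, so `x^{-θ}` solves a linear equation and `x` is explicit (`survivalSolution`).
With `x_T = 1 - s`, the sum of `P(Z_t = n)(1 - x_t)^n` over `n` does not depend on `t`; comparing `t
= 0` with `t = T` gives the formula. The sum is truncated at `N`; the resulting error is of order `N
r^N` with `r < 1`. As the environment is only measurable, derivatives exist almost everywhere and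
absolute continuity replaces differentiability.

Letting `s → 1` yields `μ_t = exp E_t`, hence `w = μ^{-θ}`; taking `s = 0` expresses the extinction
probability through `B + w`, which is nondecreasing. Integration by parts gives `B = V + (1+θ)⁻¹(1 -
w)`. If `Λ < ∞`, all these quantities converge to finite limits and the process is asymptotically
degenerate. Conversely, `q < 1` bounds `B + w`, hence `V`, and makes `w` converge; `liminf μ_t < ∞`
makes its limit positive, and then the bound on `V` bounds `Λ`.

For almost sure convergence, the probability of any change of state after `T` is at most `sup μ · (Λ
- Λ_T)`, which tends to zero. So paths are eventually constant, and the law of the limit follows by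
dominated convergence. -/

theorem thetaLaw_le_one {θ a : ℝ} (h0 : 0 < θ) (h1 : θ ≤ 1) (ha : 0 ≤ a)
    (ha' : a ≤ 1 + 1 / θ) (k : ℕ) : thetaLaw θ a k ≤ 1 := by
  have h := thetaLaw_hasSum h0 h1 ha ha' zero_le_one le_rfl
  have h2 : thetaPGF θ a 1 = 1 := by
    simp [thetaPGF, Real.zero_rpow (by linarith : (1 + θ) ≠ 0)]
  rw [h2] at h
  simpa using le_hasSum h k fun j _ => by
    simpa using thetaLaw_nonneg h0 h1 ha ha' j

theorem measurable_thetaLaw (θ : ℝ) {a : ℝ → ℝ} (ha : Measurable a) (k : ℕ) :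
    Measurable fun t => thetaLaw θ (a t) k := by
  match k with
  | 0 => simp only [thetaLaw]; fun_prop
  | 1 => simp only [thetaLaw]; fun_prop
  | n + 2 => simp only [thetaLaw]; fun_prop

/-- The action of the branching generator of unit rate on the indicator of `n`. -/
noncomputable def jumpKernel (p : ℕ → ℝ) (n m : ℕ) : ℝ :=
  (m : ℝ) * ((if m ≤ n + 1 then p (n + 1 - m) else 0) - if m = n then 1 else 0)

theorem generator_single (r : ℝ) (p : ℕ → ℝ) (n m : ℕ) :
    generator r p (Pi.single n 1) m = r * jumpKernel p n m := by
  -- At `m = 0` truncated subtraction gives `m - 1 + k` a meaningless value, but the factor `m`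
  -- kills both sides.
  rcases Nat.eq_zero_or_pos m with rfl | hm
  · simp [generator, jumpKernel]
  have h1 : ∑' k, p k * (Pi.single n 1 : ℕ → ℝ) (m - 1 + k)
      = if m ≤ n + 1 then p (n + 1 - m) else 0 := by
    split_ifs with h
    · rw [tsum_eq_single (n + 1 - m)]
      · rw [show m - 1 + (n + 1 - m) = n by lia]; simp
      · intro k hk
        rw [Pi.single_eq_of_ne (by lia)]; simp
    · convert tsum_zero with k
      rw [Pi.single_eq_of_ne (by lia)]; simp
  rw [generator, h1, jumpKernel, Pi.single_apply]
  ring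

/-- A death lowers the population by at most one, so `n` is reached only from `m ≤ n + 1`. The bound
is therefore uniform in `m`, and the forward equation makes sense before any moment of the process
is known to be finite. -/
theorem abs_jumpKernel_le {p : ℕ → ℝ} (h0 : ∀ k, 0 ≤ p k) (h1 : ∀ k, p k ≤ 1) (n m : ℕ) :
    |jumpKernel p n m| ≤ n + 1 := by
  unfold jumpKernel
  by_cases h : m ≤ n + 1
  · rw [abs_mul, Nat.abs_cast]
    have hm : (m : ℝ) ≤ n + 1 := by exact_mod_cast h
    have h2 : |(if m ≤ n + 1 then p (n + 1 - m) else 0) - if m = n then (1 : ℝ) else 0| ≤ 1 := by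
      rw [if_pos h, abs_le]
      have := h0 (n + 1 - m)
      have := h1 (n + 1 - m)
      split_ifs <;> constructor <;> linarith
    nlinarith [abs_nonneg ((if m ≤ n + 1 then p (n + 1 - m) else 0) - if m = n then (1 : ℝ) else 0)]
  · rw [if_neg h, if_neg (by lia)]
    simp; positivity

/-- Mass is lost by state `n` only through a death in state `n`; the gains from other states are
dropped. -/
theorem neg_le_jumpKernel {p : ℕ → ℝ} (h0 : ∀ k, 0 ≤ p k) (n m : ℕ) :
    -((n : ℝ) * if m = n then 1 else 0) ≤ jumpKernel p n m := by
  unfold jumpKernel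
  have hp : 0 ≤ (m : ℝ) * if m ≤ n + 1 then p (n + 1 - m) else 0 := by
    split_ifs
    · exact mul_nonneg (by positivity) (h0 _)
    · simp
  rw [mul_sub]
  by_cases h : m = n
  · subst h; linarith
  · simp only [if_neg h] at *; linarith

theorem measurable_jumpKernel {p : ℝ → ℕ → ℝ} (hp : ∀ k, Measurable fun t => p t k) (n : ℕ) :
    Measurable fun x : ℝ × ℕ => jumpKernel (p x.1) n x.2 := by
  refine measurable_from_prod_countable_left fun m => ?_
  simp only [jumpKernel]
  split_ifs <;> fun_prop (disch := assumption)

variable {Ω : Type*} [MeasurableSpace Ω]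

/-- By right continuity the path at `t` is the limit of its values on grids of mesh `1 / (k + 1)`;
the floor plus one keeps the grid point to the right of `t`. -/
theorem measurable_uncurry_of_rightContinuous {Z : ℝ≥0 → Ω → ℕ} (hZ : ∀ t, Measurable (Z t))
    (hc : ∀ ω t, ContinuousWithinAt (fun u => Z u ω) (Ici t) t) :
    Measurable fun x : ℝ≥0 × Ω => Z x.1 x.2 := by
  let τ : ℕ → ℝ≥0 → ℝ≥0 := fun k t => ((⌊t * (k + 1)⌋₊ + 1 : ℕ) : ℝ≥0) / (k + 1)
  have hlt : ∀ k t, t ≤ τ k t := fun k t => by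
    simp only [τ]
    rw [le_div_iff₀ (by positivity)]
    push_cast
    exact (Nat.lt_floor_add_one _).le
  have hle : ∀ k t, τ k t ≤ t + 1 / ((k : ℝ≥0) + 1) := fun k t => by
    simp only [τ]
    rw [div_le_iff₀ (by positivity), add_mul, one_div, inv_mul_cancel₀ (by positivity)]
    push_cast
    gcongr
    exact Nat.floor_le (by positivity)
  refine measurable_of_tendsto_metrizable (f := fun k (x : ℝ≥0 × Ω) => Z (τ k x.1) x.2)
    (fun k => ?_) ?_
  · have h : Measurable fun y : ℕ × Ω => Z (((y.1 + 1 : ℕ) : ℝ≥0) / (k + 1)) y.2 :=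
      measurable_from_prod_countable_right fun j =>
        (hZ _ : Measurable (Z (((j + 1 : ℕ) : ℝ≥0) / (k + 1))))
    exact h.comp (((Nat.measurable_floor.comp (measurable_id.mul_const _)).comp
      measurable_fst).prodMk measurable_snd)
  · rw [tendsto_pi_nhds]
    rintro ⟨t, ω⟩
    have h1 : Tendsto (fun k => τ k t) atTop (𝓝[≥] t) := by
      refine tendsto_nhdsWithin_iff.2 ⟨?_, Eventually.of_forall fun k => hlt k t⟩
      refine tendsto_of_tendsto_of_tendsto_of_le_of_le tendsto_const_nhds ?_
        (fun k => hlt k t) (fun k => hle k t)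
      have := (tendsto_one_div_add_atTop_nhds_zero_nat (𝕜 := ℝ≥0)).const_add t
      simpa using this
    exact (hc ω t).tendsto.comp h1

end VaryingBranching

/-! ### Forward equation -/

namespace VaryingBranching

variable {Ω : Type*} [MeasurableSpace Ω]

section Environment

variable {θ : ℝ} {lam a : ℝ → ℝ}

theorem IsThetaEnvironment.intervalIntegrable_rate (h : IsThetaEnvironment θ lam a) {s t : ℝ}
    (hs : 0 ≤ s) (ht : 0 ≤ t) : IntervalIntegrable lam volume s t := by
  rw [intervalIntegrable_iff]
  refine (h.integrable_rate (max s t) (le_max_of_le_left hs)).mono_set fun x hx => ?_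
  exact ⟨(le_min hs ht).trans_lt hx.1, hx.2⟩

/-- The rate times a bounded measurable function is integrable on bounded intervals. -/
theorem IsThetaEnvironment.intervalIntegrable_rate_mul (h : IsThetaEnvironment θ lam a) {s t : ℝ}
    (hs : 0 ≤ s) (ht : 0 ≤ t) {g : ℝ → ℝ} (hg : AEStronglyMeasurable g (volume.restrict (uIoc s t)))
    {C : ℝ} (hC : ∀ u ∈ uIoc s t, |g u| ≤ C) :
    IntervalIntegrable (fun u => lam u * g u) volume s t := by
  rw [intervalIntegrable_iff]
  refine Integrable.mul_bdd (c := C) ?_ hg ?_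
  · exact intervalIntegrable_iff.1 (h.intervalIntegrable_rate hs ht)
  · exact (ae_restrict_iff' measurableSet_uIoc).2 (Eventually.of_forall hC)

end Environment

variable {P : Measure Ω} {θ : ℝ} {lam a : ℝ → ℝ} {Z : ℝ≥0 → Ω → ℕ}

theorem IsThetaPositive.measurable (hZ : IsThetaPositive P θ lam a Z) (t : ℝ≥0) :
    Measurable (Z t) := (hZ.branching.stronglyMeasurable t).measurable

theorem IsThetaPositive.law_nonneg (hZ : IsThetaPositive P θ lam a Z) {r : ℝ} (hr : 0 ≤ r) (k : ℕ) :
    0 ≤ thetaLaw θ (a r) k :=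
  thetaLaw_nonneg hZ.parameter_pos hZ.parameter_le_one (hZ.environment.mean_nonneg r hr)
    (hZ.environment.mean_le r hr) k

theorem IsThetaPositive.abs_jumpKernel_le (hZ : IsThetaPositive P θ lam a Z) {r : ℝ} (hr : 0 ≤ r)
    (n m : ℕ) : |jumpKernel (thetaLaw θ (a r)) n m| ≤ n + 1 :=
  VaryingBranching.abs_jumpKernel_le (hZ.law_nonneg hr)
    (thetaLaw_le_one hZ.parameter_pos hZ.parameter_le_one (hZ.environment.mean_nonneg r hr)
    (hZ.environment.mean_le r hr)) n m

theorem IsThetaPositive.measurable_jumpKernel_uncurry (hZ : IsThetaPositive P θ lam a Z) (n : ℕ) :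
    Measurable fun x : ℝ × Ω => jumpKernel (thetaLaw θ (a x.1)) n (Z x.1.toNNReal x.2) :=
  (measurable_jumpKernel (measurable_thetaLaw θ hZ.environment.measurable_mean) n).comp
    (measurable_fst.prodMk ((measurable_uncurry_of_rightContinuous hZ.measurable
      hZ.branching.right_continuous).comp
      ((measurable_real_toNNReal.comp measurable_fst).prodMk measurable_snd)))

/-- Kolmogorov's forward equation in integrated form, conditionally on an event of the past. -/
theorem IsThetaPositive.forward_equation [IsProbabilityMeasure P] (hZ : IsThetaPositive P θ lam a Z) {u v : ℝ≥0}
    (huv : u ≤ v) {A : Set Ω}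
    (hA : MeasurableSet[Filtration.natural Z hZ.branching.stronglyMeasurable u] A) (n : ℕ) :
    P.real (A ∩ Z v ⁻¹' {n}) - P.real (A ∩ Z u ⁻¹' {n}) =
      ∫ r in (u : ℝ)..v, lam r * ∫ ω in A, jumpKernel (thetaLaw θ (a r)) n (Z r.toNNReal ω) ∂P := by
  have hA' : MeasurableSet A := (Filtration.natural Z hZ.branching.stronglyMeasurable).le u A hA
  have huv' : (u : ℝ) ≤ v := by exact_mod_cast huv
  have hM := hZ.branching.martingale (Pi.single n 1)
    ((finite_singleton n).subset Pi.support_single_subset)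
  have hset := hM.setIntegral_eq huv hA
  have hindi : ∀ t : ℝ≥0, (fun ω => (Pi.single n 1 : ℕ → ℝ) (Z t ω))
      = (Z t ⁻¹' {n}).indicator 1 := fun t => by
    ext ω
    by_cases h : Z t ω = n
    · rw [indicator_of_mem (by simpa using h), h]; simp
    · rw [indicator_of_notMem (by simpa using h), Pi.single_eq_of_ne h]
  have hms : ∀ t, MeasurableSet (Z t ⁻¹' {n}) := fun t => hZ.measurable t (measurableSet_singleton n)
  have hind : ∀ t : ℝ≥0, Integrable (fun ω => (Pi.single n 1 : ℕ → ℝ) (Z t ω)) P := fun t => by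
    rw [hindi]; exact (integrable_const 1).indicator (hms t)
  have hindI : ∀ t : ℝ≥0, ∫ ω in A, (Pi.single n 1 : ℕ → ℝ) (Z t ω) ∂P
      = P.real (A ∩ Z t ⁻¹' {n}) := fun t => by
    rw [hindi, integral_indicator_one (hms t), measureReal_restrict_apply (hms t), inter_comm]
  have hmeas := hZ.measurable_jumpKernel_uncurry n
  -- The compensator is integrable as the difference of the bounded indicator and the martingale.
  have hint : ∀ t : ℝ≥0, Integrable (fun ω => ∫ r in (0 : ℝ)..t, generator (lam r)
      (thetaLaw θ (a r)) (Pi.single n 1) (Z r.toNNReal ω)) P := fun t => by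
    refine ((hind t).sub (hM.integrable t)).congr (Eventually.of_forall fun ω => ?_)
    simp
  have hpath : ∀ (s t : ℝ≥0) (ω : Ω), IntervalIntegrable (fun r => generator (lam r)
      (thetaLaw θ (a r)) (Pi.single n 1) (Z r.toNNReal ω)) volume s t := fun s t ω => by
    simp only [generator_single]
    refine hZ.environment.intervalIntegrable_rate_mul s.2 t.2 (C := n + 1)
      (hmeas.comp measurable_prodMk_right).aestronglyMeasurable fun r hr => ?_
    exact hZ.abs_jumpKernel_le ((le_min s.2 t.2).trans hr.1.le) n _
  rw [integral_sub (hind u).integrableOn (hint u).integrableOn,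
    integral_sub (hind v).integrableOn (hint v).integrableOn, hindI, hindI] at hset
  have h1 : P.real (A ∩ Z v ⁻¹' {n}) - P.real (A ∩ Z u ⁻¹' {n}) =
      ∫ ω in A, (∫ r in (u : ℝ)..v, lam r * jumpKernel (thetaLaw θ (a r)) n (Z r.toNNReal ω)) ∂P := by
    simp only [← generator_single]
    have h2 : ∀ ω, (∫ r in (u : ℝ)..v, generator (lam r)
        (thetaLaw θ (a r)) (Pi.single n 1) (Z r.toNNReal ω)) =
        (∫ r in (0 : ℝ)..v, generator (lam r)
        (thetaLaw θ (a r)) (Pi.single n 1) (Z r.toNNReal ω)) -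
        ∫ r in (0 : ℝ)..u, generator (lam r)
        (thetaLaw θ (a r)) (Pi.single n 1) (Z r.toNNReal ω) := fun ω =>
      (intervalIntegral.integral_interval_sub_left (by simpa using hpath 0 v ω)
        (by simpa using hpath 0 u ω)).symm
    simp only [h2]
    rw [integral_sub (hint v).integrableOn (hint u).integrableOn]
    linarith
  rw [h1]
  simp only [intervalIntegral.integral_of_le huv']
  rw [integral_integral_swap]
  · simp only [integral_const_mul]
  · have hl : Integrable (fun x : Ω × ℝ => lam x.2)
        ((P.restrict A).prod (volume.restrict (Ioc (u : ℝ) v))) :=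
      ((hZ.environment.integrable_rate v v.2).mono_set (Ioc_subset_Ioc_left u.2)).comp_snd _
    refine hl.mul_bdd (c := n + 1) (hmeas.comp measurable_swap).aestronglyMeasurable ?_
    have h3 : ∀ᵐ x ∂((P.restrict A).prod (volume.restrict (Ioc (u : ℝ) v))), x.2 ∈ Ioc (u : ℝ) v :=
      Measure.quasiMeasurePreserving_snd.ae (ae_restrict_mem measurableSet_Ioc)
    filter_upwards [h3] with x hx
    exact hZ.abs_jumpKernel_le (u.2.trans hx.1.le) n _

end VaryingBranching

/-! ### Absolutely continuous solutions of the linear equations -/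

namespace VaryingBranching

/-- The image of the interval under `g` is compact and convex, so the `C¹` function `f` is Lipschitz
on it. -/
theorem absolutelyContinuousOnInterval_comp {f g : ℝ → ℝ} {s t : ℝ}
    (hg : AbsolutelyContinuousOnInterval g s t) (hf : ContDiffOn ℝ 1 f (g '' uIcc s t)) :
    AbsolutelyContinuousOnInterval (fun x => f (g x)) s t := by
  have hconv : Convex ℝ (g '' uIcc s t) :=
    ((isPreconnected_uIcc.image g hg.continuousOn).ordConnected).convex
  obtain ⟨K, hK⟩ := hf.exists_lipschitzOnWith (by decide) hconv
    (isCompact_uIcc.image_of_continuousOn hg.continuousOn)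
  rw [absolutelyContinuousOnInterval_iff] at hg ⊢
  intro ε hε
  -- The Lipschitz constant `K` may vanish, hence `K + 1`.
  obtain ⟨δ, hδ, h⟩ := hg (ε / (K + 1)) (by positivity)
  refine ⟨δ, hδ, fun E hE hEδ => ?_⟩
  have hE' := h E hE hEδ
  calc
    _ ≤ ∑ i ∈ Finset.range E.1, (K + 1) * dist (g (E.2 i).1) (g (E.2 i).2) := by
      refine Finset.sum_le_sum fun i hi => ?_
      have h1 := hE.1 i hi
      refine (hK.dist_le_mul _ (mem_image_of_mem g h1.1) _ (mem_image_of_mem g h1.2)).trans ?_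
      gcongr
      exact le_add_of_nonneg_right zero_le_one
    _ = (K + 1) * ∑ i ∈ Finset.range E.1, dist (g (E.2 i).1) (g (E.2 i).2) :=
      (Finset.mul_sum _ _ _).symm
    _ < (K + 1) * (ε / (K + 1)) := by gcongr
    _ = ε := by field_simp

theorem absolutelyContinuousOnInterval_const (c s t : ℝ) :
    AbsolutelyContinuousOnInterval (fun _ => c) s t :=
  (contDiffOn_const (n := 1)).absolutelyContinuousOnInterval

/-- The logarithm of the mean population size. -/
noncomputable def logMean (lam a : ℝ → ℝ) (t : ℝ) : ℝ :=
  ∫ u in (0 : ℝ)..t, lam u * (a u - 1)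

/-- The power `-θ` of the mean population size. -/
noncomputable def meanWeight (θ : ℝ) (lam a : ℝ → ℝ) (t : ℝ) : ℝ :=
  Real.exp (-θ * logMean lam a t)

/-- The constant term in the solution of the Bernoulli equation for the generating function. -/
noncomputable def bernoulliTerm (θ : ℝ) (lam a : ℝ → ℝ) (t : ℝ) : ℝ :=
  ∫ u in (0 : ℝ)..t, lam u * (θ * (1 + θ)⁻¹ * a u * meanWeight θ lam a u)

theorem meanWeight_pos (θ : ℝ) (lam a : ℝ → ℝ) (t : ℝ) : 0 < meanWeight θ lam a t :=
  Real.exp_pos _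

namespace IsThetaEnvironment

variable {θ : ℝ} {lam a : ℝ → ℝ}

theorem abs_mean_sub_one_le (h : IsThetaEnvironment θ lam a) (hθ : 0 < θ) {t : ℝ} (ht : 0 ≤ t) :
    |a t - 1| ≤ 1 + 1 / θ := by
  have h1 := h.mean_nonneg t ht
  have h2 := h.mean_le t ht
  have : 0 < 1 / θ := by positivity
  rw [abs_le]; constructor <;> linarith

theorem intervalIntegrable_logMean (h : IsThetaEnvironment θ lam a) (hθ : 0 < θ) {s t : ℝ}
    (hs : 0 ≤ s) (ht : 0 ≤ t) :
    IntervalIntegrable (fun u => lam u * (a u - 1)) volume s t :=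
  h.intervalIntegrable_rate_mul hs ht (h.measurable_mean.sub_const 1).aestronglyMeasurable
    fun _ hu => h.abs_mean_sub_one_le hθ ((le_min hs ht).trans hu.1.le)

theorem absolutelyContinuous_logMean (h : IsThetaEnvironment θ lam a) (hθ : 0 < θ) {t : ℝ}
    (ht : 0 ≤ t) : AbsolutelyContinuousOnInterval (logMean lam a) 0 t :=
  (h.intervalIntegrable_logMean hθ le_rfl ht).absolutelyContinuousOnInterval_intervalIntegral
    left_mem_uIcc

theorem absolutelyContinuous_meanWeight (h : IsThetaEnvironment θ lam a) (hθ : 0 < θ) {t : ℝ}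
    (ht : 0 ≤ t) : AbsolutelyContinuousOnInterval (meanWeight θ lam a) 0 t :=
  absolutelyContinuousOnInterval_comp (f := Real.exp)
    ((h.absolutelyContinuous_logMean hθ ht).const_mul (-θ)) Real.contDiff_exp.contDiffOn

theorem ae_hasDerivAt_logMean (h : IsThetaEnvironment θ lam a) (hθ : 0 < θ) {t : ℝ}
    (ht : 0 ≤ t) :
    ∀ᵐ x, x ∈ uIcc 0 t → HasDerivAt (logMean lam a) (lam x * (a x - 1)) x := by
  filter_upwards [(h.intervalIntegrable_logMean hθ le_rfl ht).ae_hasDerivAt_integral] with x hx hxt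
  exact hx hxt 0 left_mem_uIcc

theorem hasDerivAt_meanWeight {x d : ℝ} (hd : HasDerivAt (logMean lam a) d x) :
    HasDerivAt (meanWeight θ lam a) (-θ * d * meanWeight θ lam a x) x := by
  have h := (hd.const_mul (-θ)).exp
  rwa [mul_comm] at h

/-- Integrability on bounded intervals of the rate times a bounded function times the weight. -/
theorem intervalIntegrable_mul_meanWeight (h : IsThetaEnvironment θ lam a) (hθ : 0 < θ) {s t : ℝ}
    (hs : 0 ≤ s) (hst : s ≤ t) {g : ℝ → ℝ} (hg : Measurable g) {C : ℝ}
    (hC : ∀ u, 0 ≤ u → |g u| ≤ C) :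
    IntervalIntegrable (fun u => lam u * (g u * meanWeight θ lam a u)) volume s t := by
  have ht := hs.trans hst
  have hsub : uIcc s t ⊆ uIcc 0 t := by
    rw [uIcc_of_le hst, uIcc_of_le ht]; exact Icc_subset_Icc_left hs
  have hc := (h.absolutelyContinuous_meanWeight hθ ht).continuousOn.mono hsub
  rw [show (fun u => lam u * (g u * meanWeight θ lam a u)) =
    fun u => (lam u * g u) * meanWeight θ lam a u from funext fun u => by ring]
  refine IntervalIntegrable.mul_continuousOn ?_ hc
  exact h.intervalIntegrable_rate_mul hs ht hg.aestronglyMeasurable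
    fun u hu => hC u ((le_min hs ht).trans hu.1.le)

theorem intervalIntegrable_bernoulliTerm (h : IsThetaEnvironment θ lam a) (hθ : 0 < θ) {s t : ℝ}
    (hs : 0 ≤ s) (hst : s ≤ t) :
    IntervalIntegrable (fun u => lam u * (θ * (1 + θ)⁻¹ * a u * meanWeight θ lam a u))
      volume s t := by
  refine h.intervalIntegrable_mul_meanWeight hθ hs hst (h.measurable_mean.const_mul _)
    (C := θ * (1 + θ)⁻¹ * (1 + 1 / θ)) fun u hu => ?_
  have h1 := h.mean_nonneg u hu
  rw [abs_of_nonneg (by positivity)]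
  gcongr
  exact h.mean_le u hu

theorem absolutelyContinuous_bernoulliTerm (h : IsThetaEnvironment θ lam a) (hθ : 0 < θ) {t : ℝ}
    (ht : 0 ≤ t) : AbsolutelyContinuousOnInterval (bernoulliTerm θ lam a) 0 t :=
  (h.intervalIntegrable_bernoulliTerm hθ le_rfl ht).absolutelyContinuousOnInterval_intervalIntegral
    left_mem_uIcc

theorem ae_hasDerivAt_bernoulliTerm (h : IsThetaEnvironment θ lam a) (hθ : 0 < θ) {t : ℝ}
    (ht : 0 ≤ t) :
    ∀ᵐ x, x ∈ uIcc 0 t → HasDerivAt (bernoulliTerm θ lam a)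
      (lam x * (θ * (1 + θ)⁻¹ * a x * meanWeight θ lam a x)) x := by
  filter_upwards [(h.intervalIntegrable_bernoulliTerm hθ le_rfl ht).ae_hasDerivAt_integral]
    with x hx hxt
  exact hx hxt 0 left_mem_uIcc

theorem meanWeight_eq_integral (h : IsThetaEnvironment θ lam a) (hθ : 0 < θ) {t : ℝ}
    (ht : 0 ≤ t) :
    meanWeight θ lam a t = 1 - ∫ u in (0 : ℝ)..t, lam u * (θ * (a u - 1) * meanWeight θ lam a u) := by
  have h1 := (h.absolutelyContinuous_meanWeight hθ ht).integral_deriv_eq_sub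
  have h0 : meanWeight θ lam a 0 = 1 := by simp [meanWeight, logMean]
  have h2 : ∫ u in (0 : ℝ)..t, deriv (meanWeight θ lam a) u =
      ∫ u in (0 : ℝ)..t, -(lam u * (θ * (a u - 1) * meanWeight θ lam a u)) := by
    refine intervalIntegral.integral_congr_ae ?_
    filter_upwards [h.ae_hasDerivAt_logMean hθ ht] with x hx hxt
    rw [(hasDerivAt_meanWeight (hx (uIoc_subset_uIcc hxt))).deriv]; ring
  rw [h2, intervalIntegral.integral_neg, h0] at h1
  linarith

/-- Split `a = 1 + (a - 1)`: the first part is `V` once `w` is known to be `μ^{-θ}`, and the second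
is a multiple of the derivative of the weight, so it integrates exactly. -/
theorem bernoulliTerm_eq (h : IsThetaEnvironment θ lam a) (hθ : 0 < θ) {t : ℝ} (ht : 0 ≤ t) :
    bernoulliTerm θ lam a t = θ * (1 + θ)⁻¹ * (∫ u in (0 : ℝ)..t, lam u * meanWeight θ lam a u) +
      (1 + θ)⁻¹ * (1 - meanWeight θ lam a t) := by
  have h1 : IntervalIntegrable (fun u => lam u * meanWeight θ lam a u) volume 0 t := by
    simpa using h.intervalIntegrable_mul_meanWeight hθ le_rfl ht (g := fun _ => 1)
      measurable_const (C := 1) (by simp)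
  have h2 : IntervalIntegrable (fun u => lam u * (θ * (a u - 1) * meanWeight θ lam a u))
      volume 0 t := by
    refine h.intervalIntegrable_mul_meanWeight hθ le_rfl ht
      (g := fun u => θ * (a u - 1)) ((h.measurable_mean.sub_const 1).const_mul θ)
      (C := θ * (1 + 1 / θ)) fun u hu => ?_
    rw [abs_mul, abs_of_pos hθ]
    gcongr
    exact h.abs_mean_sub_one_le hθ hu
  rw [h.meanWeight_eq_integral hθ ht, sub_sub_cancel, ← intervalIntegral.integral_const_mul,
    ← intervalIntegral.integral_const_mul, ← intervalIntegral.integral_add (h1.const_mul _)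
    (h2.const_mul _), bernoulliTerm]
  refine intervalIntegral.integral_congr fun u _ => ?_
  ring

/-- The monotone quantity which governs the extinction probabilities. -/
theorem bernoulliTerm_add_meanWeight_mono (h : IsThetaEnvironment θ lam a) (hθ : 0 < θ) {s t : ℝ}
    (hs : 0 ≤ s) (hst : s ≤ t) :
    bernoulliTerm θ lam a s + meanWeight θ lam a s ≤
      bernoulliTerm θ lam a t + meanWeight θ lam a t := by
  -- The integrand contains the factor `1 - θ(1+θ)⁻¹a`, the probability of having no offspring; its
  -- sign is where `a ≤ 1 + 1/θ` enters.
  have key : ∀ r, 0 ≤ r → bernoulliTerm θ lam a r + meanWeight θ lam a r =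
      1 + ∫ u in (0 : ℝ)..r, lam u * (θ * (1 - θ * (1 + θ)⁻¹ * a u) * meanWeight θ lam a u) := by
    intro r hr
    have h2 : IntervalIntegrable (fun u => lam u * (θ * (a u - 1) * meanWeight θ lam a u))
        volume 0 r := by
      refine h.intervalIntegrable_mul_meanWeight hθ le_rfl hr
        (g := fun u => θ * (a u - 1)) ((h.measurable_mean.sub_const 1).const_mul θ)
        (C := θ * (1 + 1 / θ)) fun u hu => ?_
      rw [abs_mul, abs_of_pos hθ]
      gcongr
      exact h.abs_mean_sub_one_le hθ hu
    rw [h.meanWeight_eq_integral hθ hr, bernoulliTerm, add_sub_left_comm,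
      ← intervalIntegral.integral_sub (h.intervalIntegrable_bernoulliTerm hθ le_rfl hr) h2]
    congr 1
    refine intervalIntegral.integral_congr fun u _ => ?_
    field_simp; ring
  have hbd : ∀ u, 0 ≤ u → 0 ≤ 1 - θ * (1 + θ)⁻¹ * a u ∧ 1 - θ * (1 + θ)⁻¹ * a u ≤ 1 := by
    intro u hu
    have h1 := h.mean_nonneg u hu
    have h2 : θ * (1 + θ)⁻¹ * a u ≤ θ * (1 + θ)⁻¹ * (1 + 1 / θ) := by
      gcongr; exact h.mean_le u hu
    have h3 : θ * (1 + θ)⁻¹ * (1 + 1 / θ) = 1 := by field_simp; ring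
    have h4 : 0 ≤ θ * (1 + θ)⁻¹ * a u := by positivity
    constructor <;> linarith
  have hI : ∀ r, 0 ≤ r → IntervalIntegrable (fun u => lam u * (θ * (1 - θ * (1 + θ)⁻¹ * a u)
      * meanWeight θ lam a u)) volume 0 r := fun r hr => by
    refine h.intervalIntegrable_mul_meanWeight hθ le_rfl hr
      (((h.measurable_mean.const_mul _).const_sub 1).const_mul θ) (C := θ * 1) fun u hu => ?_
    rw [abs_mul, abs_of_pos hθ, abs_of_nonneg (hbd u hu).1]
    gcongr
    exact (hbd u hu).2
  have ht := hs.trans hst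
  rw [key s hs, key t ht, ← sub_nonneg, add_sub_add_left_eq_sub,
    intervalIntegral.integral_interval_sub_left (hI t ht) (hI s hs)]
  refine intervalIntegral.integral_nonneg hst fun u hu => ?_
  have hu' := hs.trans hu.1
  have := h.rate_nonneg u hu'
  have := (hbd u hu').1
  have := meanWeight_pos θ lam a u
  positivity

theorem bernoulliTerm_nonneg (h : IsThetaEnvironment θ lam a) (hθ : 0 < θ) {t : ℝ} (ht : 0 ≤ t) :
    0 ≤ bernoulliTerm θ lam a t := by
  refine intervalIntegral.integral_nonneg ht fun u hu => ?_
  have := h.rate_nonneg u hu.1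
  have := h.mean_nonneg u hu.1
  have := meanWeight_pos θ lam a u
  positivity

end IsThetaEnvironment

end VaryingBranching

/-! ### Backward Bernoulli equation and the truncation error -/

namespace VaryingBranching

theorem absolutelyContinuousOnInterval_sum {ι : Type*} (F : Finset ι) {f : ι → ℝ → ℝ} {s t : ℝ}
    (h : ∀ i ∈ F, AbsolutelyContinuousOnInterval (f i) s t) :
    AbsolutelyContinuousOnInterval (fun x => ∑ i ∈ F, f i x) s t := by
  classical
  induction F using Finset.induction_on with
  | empty => simpa using absolutelyContinuousOnInterval_const 0 s t
  | insert i F hi ih =>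
    simp only [Finset.sum_insert hi]
    exact (h i (Finset.mem_insert_self i F)).fun_add
      (ih fun j hj => h j (Finset.mem_insert_of_mem hj))

/-- Solution of the backward equation for one minus the generating function. -/
noncomputable def survivalSolution (θ : ℝ) (lam a : ℝ → ℝ) (C t : ℝ) : ℝ :=
  Real.exp (-logMean lam a t) * (C - bernoulliTerm θ lam a t) ^ (-1 / θ)

namespace IsThetaEnvironment

variable {θ : ℝ} {lam a : ℝ → ℝ} {C T : ℝ}

/-- By monotonicity of `B + w`, a condition at time `T` alone keeps the base of the power in
`survivalSolution` positive on all of `[0, T]`. -/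
theorem meanWeight_le_sub (h : IsThetaEnvironment θ lam a) (hθ : 0 < θ)
    (hC : bernoulliTerm θ lam a T + meanWeight θ lam a T ≤ C) {t : ℝ} (ht : 0 ≤ t) (htT : t ≤ T) :
    meanWeight θ lam a t ≤ C - bernoulliTerm θ lam a t := by
  linarith [h.bernoulliTerm_add_meanWeight_mono hθ ht htT]

theorem survivalSolution_mem (h : IsThetaEnvironment θ lam a) (hθ : 0 < θ)
    (hC : bernoulliTerm θ lam a T + meanWeight θ lam a T ≤ C) {t : ℝ} (ht : 0 ≤ t) (htT : t ≤ T) :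
    survivalSolution θ lam a C t ∈ Ioc 0 1 := by
  have h1 := h.meanWeight_le_sub hθ hC ht htT
  have h2 := meanWeight_pos θ lam a t
  refine ⟨mul_pos (Real.exp_pos _) (Real.rpow_pos_of_pos (h2.trans_le h1) _), ?_⟩
  have h3 : (C - bernoulliTerm θ lam a t) ^ (-1 / θ) ≤ meanWeight θ lam a t ^ (-1 / θ) :=
    Real.rpow_le_rpow_of_nonpos h2 h1 (by rw [neg_div]; simpa using hθ.le)
  have h4 : meanWeight θ lam a t ^ (-1 / θ) = Real.exp (logMean lam a t) := by
    rw [meanWeight, ← Real.exp_mul]; congr 1; field_simp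
  calc survivalSolution θ lam a C t
      ≤ Real.exp (-logMean lam a t) * Real.exp (logMean lam a t) := by
        rw [← h4]; exact mul_le_mul_of_nonneg_left h3 (Real.exp_pos _).le
    _ = 1 := by rw [← Real.exp_add]; simp

theorem absolutelyContinuous_survivalSolution (h : IsThetaEnvironment θ lam a) (hθ : 0 < θ)
    (hT : 0 ≤ T) (hC : bernoulliTerm θ lam a T + meanWeight θ lam a T ≤ C) :
    AbsolutelyContinuousOnInterval (survivalSolution θ lam a C) 0 T := by
  refine AbsolutelyContinuousOnInterval.fun_mul ?_ ?_
  · exact absolutelyContinuousOnInterval_comp (f := Real.exp)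
      (h.absolutelyContinuous_logMean hθ hT).fun_neg Real.contDiff_exp.contDiffOn
  · refine absolutelyContinuousOnInterval_comp (f := fun y => y ^ (-1 / θ))
      (g := fun t => C - bernoulliTerm θ lam a t)
      ((absolutelyContinuousOnInterval_const C 0 T).fun_sub
        (h.absolutelyContinuous_bernoulliTerm hθ hT)) ?_
    refine contDiffOn_id.rpow_const_of_ne ?_
    rintro _ ⟨t, ht, rfl⟩
    rw [uIcc_of_le hT] at ht
    exact ((meanWeight_pos θ lam a t).trans_le (h.meanWeight_le_sub hθ hC ht.1 ht.2)).ne'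

theorem ae_hasDerivAt_survivalSolution (h : IsThetaEnvironment θ lam a) (hθ : 0 < θ)
    (hT : 0 ≤ T) (hC : bernoulliTerm θ lam a T + meanWeight θ lam a T ≤ C) :
    ∀ᵐ t, t ∈ uIcc 0 T → HasDerivAt (survivalSolution θ lam a C)
      (lam t * (thetaPGF θ (a t) (1 - survivalSolution θ lam a C t)
        - (1 - survivalSolution θ lam a C t))) t := by
  filter_upwards [h.ae_hasDerivAt_logMean hθ hT, h.ae_hasDerivAt_bernoulliTerm hθ hT]
    with t hE hB htT
  have htT' := htT
  rw [uIcc_of_le hT] at htT'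
  have hpos : 0 < C - bernoulliTerm θ lam a t :=
    (meanWeight_pos θ lam a t).trans_le (h.meanWeight_le_sub hθ hC htT'.1 htT'.2)
  have hd := ((hE htT).neg.exp).mul (((hB htT).const_sub C).rpow_const (p := -1 / θ)
    (Or.inl hpos.ne'))
  refine hd.congr_deriv ?_
  -- Since `x^θ = w / (C - B)`, the nonlinear term is `x` times a rational expression, and the
  -- equation becomes an algebraic identity.
  have hx : survivalSolution θ lam a C t ^ (1 + θ) = survivalSolution θ lam a C t *
      (meanWeight θ lam a t * (C - bernoulliTerm θ lam a t)⁻¹) := by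
    have hs := (h.survivalSolution_mem hθ hC htT'.1 htT'.2).1
    rw [Real.rpow_add hs, Real.rpow_one]
    congr 1
    rw [survivalSolution, Real.mul_rpow (Real.exp_pos _).le (Real.rpow_nonneg hpos.le _),
      ← Real.exp_mul, ← Real.rpow_mul hpos.le, show -1 / θ * θ = -1 by field_simp,
      Real.rpow_neg_one, meanWeight]
    congr 2; ring
  have hp : (C - bernoulliTerm θ lam a t) ^ (-1 / θ - 1) =
      (C - bernoulliTerm θ lam a t) ^ (-1 / θ) * (C - bernoulliTerm θ lam a t)⁻¹ := by
    rw [Real.rpow_sub hpos, Real.rpow_one, div_eq_mul_inv]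
  simp only [thetaPGF, sub_sub_cancel]
  rw [hx, hp]
  simp only [survivalSolution, Pi.neg_apply]
  field_simp
  ring

end IsThetaEnvironment

theorem sum_range_shift (p : ℕ → ℝ) (ρ : ℝ) (N j : ℕ) :
    ∑ n ∈ Finset.range (N + 1), ρ ^ n * (if j + 1 ≤ n + 1 then p (n + 1 - (j + 1)) else 0) =
      ρ ^ j * ∑ k ∈ Finset.range (N + 1 - j), p k * ρ ^ k := by
  rcases le_total j (N + 1) with hj | hj
  · obtain ⟨K, hK⟩ := Nat.exists_eq_add_of_le hj
    rw [hK, Finset.sum_range_add, Nat.add_sub_cancel_left, Finset.mul_sum, Finset.sum_eq_zero,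
      zero_add]
    · refine Finset.sum_congr rfl fun k _ => ?_
      rw [if_pos (by lia), show j + k + 1 - (j + 1) = k by lia]; ring
    · intro n hn
      rw [if_neg (by have := Finset.mem_range.1 hn; lia), mul_zero]
  · rw [Nat.sub_eq_zero_of_le hj, Finset.sum_range_zero, mul_zero]
    refine Finset.sum_eq_zero fun n hn => ?_
    rw [if_neg (by have := Finset.mem_range.1 hn; lia), mul_zero]

/-- The tail of the power series is at most `ρ ^ K` times the tail of the distribution, which is at
most one. -/
theorem abs_hasSum_sub_sum_range_le {p : ℕ → ℝ} {ρ h : ℝ} (hp : ∀ k, 0 ≤ p k) (hp1 : HasSum p 1)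
    (hρ : 0 ≤ ρ) (hρ1 : ρ ≤ 1) (hh : HasSum (fun k => p k * ρ ^ k) h) (K : ℕ) :
    |∑ k ∈ Finset.range K, p k * ρ ^ k - h| ≤ ρ ^ K := by
  have h1 := (hasSum_nat_add_iff' K).2 hh
  have h2 := (hasSum_nat_add_iff' K).2 hp1
  have h3 : 0 ≤ h - ∑ k ∈ Finset.range K, p k * ρ ^ k :=
    h1.nonneg fun k => mul_nonneg (hp _) (pow_nonneg hρ _)
  have h4 : h - ∑ k ∈ Finset.range K, p k * ρ ^ k ≤ ρ ^ K * (1 - ∑ k ∈ Finset.range K, p k) := by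
    refine hasSum_le (fun k => ?_) h1 (h2.mul_left (ρ ^ K))
    rw [mul_comm (ρ ^ K)]
    refine mul_le_mul_of_nonneg_left ?_ (hp _)
    exact pow_le_pow_of_le_one hρ hρ1 (Nat.le_add_left _ _)
  have h5 : 0 ≤ ∑ k ∈ Finset.range K, p k := Finset.sum_nonneg fun k _ => hp k
  rw [abs_sub_comm, abs_of_nonneg h3]
  have := pow_nonneg hρ K
  nlinarith

/-- The defect in the backward equation for powers which is caused by truncation at `N`. -/
theorem abs_truncated_generator_le {p : ℕ → ℝ} {ρ h : ℝ} (hp : ∀ k, 0 ≤ p k) (hp1 : HasSum p 1)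
    (hρ : 0 ≤ ρ) (hρ1 : ρ ≤ 1) (hh : HasSum (fun k => p k * ρ ^ k) h) (N m : ℕ) :
    |∑ n ∈ Finset.range (N + 1), (jumpKernel p n m * ρ ^ n -
      (if m = n then 1 else 0) * (n * ρ ^ (n - 1) * (h - ρ)))| ≤ (N + 1) * ρ ^ N := by
  have hnn : 0 ≤ ((N : ℝ) + 1) * ρ ^ N := by positivity
  rcases m with _ | j
  · rw [Finset.sum_eq_zero]
    · simpa using hnn
    · intro n _
      rcases n with _ | n <;> simp [jumpKernel]
  have hind : ∀ g : ℕ → ℝ, ∑ n ∈ Finset.range (N + 1), (if j + 1 = n then 1 else 0) * g n =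
      if j + 1 ≤ N then g (j + 1) else 0 := fun g => by
    simp [ite_mul, Finset.sum_ite_eq]
  have hsum : ∑ n ∈ Finset.range (N + 1), (jumpKernel p n (j + 1) * ρ ^ n -
      (if j + 1 = n then 1 else 0) * (n * ρ ^ (n - 1) * (h - ρ))) =
      ((j : ℝ) + 1) * (ρ ^ j * ∑ k ∈ Finset.range (N + 1 - j), p k * ρ ^ k)
      - if j + 1 ≤ N then ((j : ℝ) + 1) * (ρ ^ (j + 1) + ρ ^ j * (h - ρ)) else 0 := by
    rw [← sum_range_shift, Finset.sum_sub_distrib, hind, Finset.mul_sum]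
    have : ∑ n ∈ Finset.range (N + 1), jumpKernel p n (j + 1) * ρ ^ n =
        ∑ n ∈ Finset.range (N + 1), ((j : ℝ) + 1) * (ρ ^ n *
          (if j + 1 ≤ n + 1 then p (n + 1 - (j + 1)) else 0)) -
        ∑ n ∈ Finset.range (N + 1), (if j + 1 = n then 1 else 0) * (((j : ℝ) + 1) * ρ ^ n) := by
      rw [← Finset.sum_sub_distrib]
      refine Finset.sum_congr rfl fun n _ => ?_
      simp only [jumpKernel]; push_cast; ring
    rw [this, hind]
    split_ifs
    · push_cast; ring
    · simp
  rw [hsum]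
  -- With `m = j + 1`: for `j < N` the defect is the cut-off tail of the offspring series; for `j =
  -- N` state `N + 1` lies outside the truncation and only its childless death, leading to `N`,
  -- contributes; for `j > N` nothing does.
  rcases lt_trichotomy j N with hj | rfl | hj
  · rw [if_pos (by lia)]
    have hb := abs_hasSum_sub_sum_range_le hp hp1 hρ hρ1 hh (N + 1 - j)
    have heq : ((j : ℝ) + 1) * (ρ ^ j * ∑ k ∈ Finset.range (N + 1 - j), p k * ρ ^ k)
        - ((j : ℝ) + 1) * (ρ ^ (j + 1) + ρ ^ j * (h - ρ)) =
        ((j : ℝ) + 1) * ρ ^ j * (∑ k ∈ Finset.range (N + 1 - j), p k * ρ ^ k - h) := by ring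
    rw [heq, abs_mul, abs_of_nonneg (by positivity)]
    calc ((j : ℝ) + 1) * ρ ^ j * |∑ k ∈ Finset.range (N + 1 - j), p k * ρ ^ k - h|
        ≤ ((j : ℝ) + 1) * ρ ^ j * ρ ^ (N + 1 - j) := by gcongr
      _ = ((j : ℝ) + 1) * ρ ^ (N + 1) := by
        rw [mul_assoc, ← pow_add, Nat.add_sub_cancel' (by lia)]
      _ ≤ ((N : ℝ) + 1) * ρ ^ N := by
        refine mul_le_mul ?_ (pow_le_pow_of_le_one hρ hρ1 (Nat.le_succ N)) (by positivity)
          (by positivity)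
        have : (j : ℝ) ≤ N := by exact_mod_cast hj.le
        linarith
  · rw [if_neg (by lia), sub_zero, Nat.add_sub_cancel_left, Finset.sum_range_one, pow_zero,
      mul_one, abs_of_nonneg (by have := hp 0; positivity)]
    have h0 : p 0 ≤ 1 := le_hasSum hp1 0 fun k _ => hp k
    gcongr
    exact mul_le_of_le_one_right (by positivity) h0
  · rw [if_neg (by lia), Nat.sub_eq_zero_of_le (by lia)]
    simpa using hnn

end VaryingBranching

/-! ### The generating function by duality -/

namespace VaryingBranching

variable {Ω : Type*} [MeasurableSpace Ω] {P : Measure Ω}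

theorem hasSum_integral_comp {X : Ω → ℕ} (hX : Measurable X) {f : ℕ → ℝ}
    (hf : Integrable (fun ω => f (X ω)) P) :
    HasSum (fun n => P.real (X ⁻¹' {n}) * f n) (∫ ω, f (X ω) ∂P) := by
  have h := hasSum_integral_iUnion (μ := P) (f := fun ω => f (X ω)) (s := fun n => X ⁻¹' {n})
    (fun n => hX (measurableSet_singleton n))
    (fun i j hij => Disjoint.preimage X (by simpa using hij)) hf.integrableOn
  rw [← preimage_iUnion, iUnion_of_singleton, preimage_univ, setIntegral_univ] at h
  have heq : (fun n => ∫ ω in X ⁻¹' {n}, f (X ω) ∂P) = fun n => P.real (X ⁻¹' {n}) * f n := by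
    funext n
    rw [setIntegral_congr_fun (g := fun _ => f n) (hX (measurableSet_singleton n))
      fun ω hω => congrArg f (show X ω = n from hω)]
    simp
  rwa [heq] at h

theorem integrable_pow_comp [IsFiniteMeasure P] {X : Ω → ℕ} (hX : Measurable X) {s : ℝ}
    (hs : 0 ≤ s) (hs1 : s ≤ 1) : Integrable (fun ω => s ^ X ω) P := by
  refine Integrable.of_bound (C := 1)
    ((measurable_from_top (f := fun n : ℕ => s ^ n)).comp hX).aestronglyMeasurable
    (Eventually.of_forall fun ω => ?_)
  rw [Real.norm_of_nonneg (pow_nonneg hs _)]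
  exact pow_le_one₀ hs hs1

namespace IsThetaPositive

variable {θ : ℝ} {lam a : ℝ → ℝ} {Z : ℝ≥0 → Ω → ℕ}

/-- The expectation of the action of the unit rate generator on the indicator of `n`. -/
noncomputable def expectedJump (P : Measure Ω) (θ : ℝ) (a : ℝ → ℝ) (Z : ℝ≥0 → Ω → ℕ) (n : ℕ)
    (r : ℝ) : ℝ := ∫ ω, jumpKernel (thetaLaw θ (a r)) n (Z r.toNNReal ω) ∂P

theorem integrable_jumpKernel [IsProbabilityMeasure P] (hZ : IsThetaPositive P θ lam a Z) (n : ℕ) {r : ℝ} (hr : 0 ≤ r) :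
    Integrable (fun ω => jumpKernel (thetaLaw θ (a r)) n (Z r.toNNReal ω)) P :=
  Integrable.of_bound (C := n + 1)
    ((hZ.measurable_jumpKernel_uncurry n).comp measurable_prodMk_left).aestronglyMeasurable
    (Eventually.of_forall fun _ => hZ.abs_jumpKernel_le hr n _)

theorem intervalIntegrable_expectedJump [IsProbabilityMeasure P]
    (hZ : IsThetaPositive P θ lam a Z) (n : ℕ) {T : ℝ}
    (hT : 0 ≤ T) : IntervalIntegrable (fun r => lam r * expectedJump P θ a Z n r) volume 0 T := by
  refine hZ.environment.intervalIntegrable_rate_mul le_rfl hT (C := n + 1) ?_ fun r hr => ?_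
  · exact ((hZ.measurable_jumpKernel_uncurry n).stronglyMeasurable.integral_prod_right'
      (ν := P)).aestronglyMeasurable
  · have hr0 : 0 ≤ r := (le_min le_rfl hT).trans hr.1.le
    have hb : ∀ ω, ‖jumpKernel (thetaLaw θ (a r)) n (Z r.toNNReal ω)‖ ≤ n + 1 := fun ω =>
      hZ.abs_jumpKernel_le hr0 n _
    simpa [expectedJump] using
      norm_integral_le_of_norm_le_const (μ := P) (Eventually.of_forall hb)

/-- The state probabilities, written as integral functions of the time. -/
noncomputable def stateProb (P : Measure Ω) (θ : ℝ) (lam a : ℝ → ℝ) (Z : ℝ≥0 → Ω → ℕ) (n : ℕ)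
    (t : ℝ) : ℝ :=
  P.real (Z 0 ⁻¹' {n}) + ∫ r in (0 : ℝ)..t, lam r * expectedJump P θ a Z n r

theorem stateProb_eq [IsProbabilityMeasure P] (hZ : IsThetaPositive P θ lam a Z) (n : ℕ) (t : ℝ≥0) :
    stateProb P θ lam a Z n t = P.real (Z t ⁻¹' {n}) := by
  have h := hZ.forward_equation (u := 0) (v := t) zero_le MeasurableSet.univ n
  simp only [univ_inter, NNReal.coe_zero, Measure.restrict_univ] at h
  simp only [stateProb, expectedJump]
  linarith

theorem stateProb_zero [IsProbabilityMeasure P] (hZ : IsThetaPositive P θ lam a Z) (n : ℕ) :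
    stateProb P θ lam a Z n 0 = if n = 1 then 1 else 0 := by
  have h := hZ.stateProb_eq n 0
  rw [NNReal.coe_zero] at h
  rw [h]
  split_ifs with hn
  · have h1 : ∀ᵐ ω ∂P, ω ∈ Z 0 ⁻¹' {n} := by
      filter_upwards [hZ.branching.initial] with ω hω
      rw [mem_preimage, hω, hn, mem_singleton_iff]
    have h2 : Z 0 ⁻¹' {n} =ᵐ[P] univ := eventuallyEq_univ.2 h1
    rw [measureReal_congr h2, probReal_univ]
  · have h1 : ∀ᵐ ω ∂P, ω ∉ Z 0 ⁻¹' {n} := by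
      filter_upwards [hZ.branching.initial] with ω hω
      rw [mem_preimage, hω, mem_singleton_iff]
      exact fun h => hn h.symm
    rw [measureReal_def, measure_eq_zero_iff_ae_notMem.2 h1, ENNReal.toReal_zero]

theorem absolutelyContinuous_stateProb [IsProbabilityMeasure P]
    (hZ : IsThetaPositive P θ lam a Z) (n : ℕ) {T : ℝ}
    (hT : 0 ≤ T) : AbsolutelyContinuousOnInterval (stateProb P θ lam a Z n) 0 T :=
  (absolutelyContinuousOnInterval_const _ 0 T).fun_add
    ((hZ.intervalIntegrable_expectedJump n hT).absolutelyContinuousOnInterval_intervalIntegral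
      left_mem_uIcc)

theorem ae_hasDerivAt_stateProb [IsProbabilityMeasure P] (hZ : IsThetaPositive P θ lam a Z) {T : ℝ}
    (hT : 0 ≤ T) : ∀ᵐ t, ∀ n, t ∈ uIcc 0 T →
      HasDerivAt (stateProb P θ lam a Z n) (lam t * expectedJump P θ a Z n t) t := by
  refine ae_all_iff.2 fun n => ?_
  filter_upwards [(hZ.intervalIntegrable_expectedJump n hT).ae_hasDerivAt_integral] with t ht htT
  exact (ht htT 0 left_mem_uIcc).const_add _

theorem law_hasSum_one (hZ : IsThetaPositive P θ lam a Z) {r : ℝ} (hr : 0 ≤ r) :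
    HasSum (thetaLaw θ (a r)) 1 := by
  have h := thetaLaw_hasSum hZ.parameter_pos hZ.parameter_le_one
    (hZ.environment.mean_nonneg r hr) (hZ.environment.mean_le r hr) zero_le_one le_rfl
  have h2 : thetaPGF θ (a r) 1 = 1 := by
    simp [thetaPGF, Real.zero_rpow (by linarith [hZ.parameter_pos] : (1 + θ) ≠ 0)]
  simpa [h2] using h

theorem abs_truncated_derivative_le [IsProbabilityMeasure P]
    (hZ : IsThetaPositive P θ lam a Z) {t ρ : ℝ} (ht : 0 ≤ t)
    (hρ : 0 ≤ ρ) (hρ1 : ρ ≤ 1) (N : ℕ) :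
    |∑ n ∈ Finset.range (N + 1), (expectedJump P θ a Z n t * ρ ^ n -
      stateProb P θ lam a Z n t * (n * ρ ^ (n - 1) * (thetaPGF θ (a t) ρ - ρ)))| ≤
      (N + 1) * ρ ^ N := by
  have hms : ∀ n, MeasurableSet (Z t.toNNReal ⁻¹' {n}) := fun n =>
    hZ.measurable _ (measurableSet_singleton n)
  have hindeq : ∀ n, (fun ω => if Z t.toNNReal ω = n then (1 : ℝ) else 0) =
      (Z t.toNNReal ⁻¹' {n}).indicator 1 := fun n => by
    ext ω
    by_cases h : Z t.toNNReal ω = n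
    · rw [if_pos h, indicator_of_mem (by simpa using h), Pi.one_apply]
    · rw [if_neg h, indicator_of_notMem (by simpa using h)]
  have hprob : ∀ n, ∫ ω, (if Z t.toNNReal ω = n then (1 : ℝ) else 0) ∂P =
      stateProb P θ lam a Z n t := fun n => by
    have := hZ.stateProb_eq n t.toNNReal
    rw [Real.coe_toNNReal t ht] at this
    rw [this, ← integral_indicator_one (hms n), hindeq]
  have hindint : ∀ n, Integrable (fun ω => if Z t.toNNReal ω = n then (1 : ℝ) else 0) P := fun n => by
    rw [hindeq]; exact (integrable_const 1).indicator (hms n)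
  have hint : ∀ n, Integrable (fun ω => jumpKernel (thetaLaw θ (a t)) n (Z t.toNNReal ω) * ρ ^ n -
      (if Z t.toNNReal ω = n then 1 else 0) * (n * ρ ^ (n - 1) * (thetaPGF θ (a t) ρ - ρ))) P :=
    fun n => ((hZ.integrable_jumpKernel n ht).mul_const _).sub ((hindint n).mul_const _)
  have heq : ∑ n ∈ Finset.range (N + 1), (expectedJump P θ a Z n t * ρ ^ n -
      stateProb P θ lam a Z n t * (n * ρ ^ (n - 1) * (thetaPGF θ (a t) ρ - ρ))) =
      ∫ ω, ∑ n ∈ Finset.range (N + 1), (jumpKernel (thetaLaw θ (a t)) n (Z t.toNNReal ω) * ρ ^ n -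
      (if Z t.toNNReal ω = n then 1 else 0) *
        (n * ρ ^ (n - 1) * (thetaPGF θ (a t) ρ - ρ))) ∂P := by
    rw [integral_finsetSum _ fun n _ => hint n]
    refine Finset.sum_congr rfl fun n _ => ?_
    rw [integral_sub ((hZ.integrable_jumpKernel n ht).mul_const _) ((hindint n).mul_const _),
      integral_mul_const, integral_mul_const, hprob]
    rfl
  rw [heq, ← Real.norm_eq_abs]
  refine (norm_integral_le_of_norm_le_const (μ := P) (C := (N + 1) * ρ ^ N)
    (Eventually.of_forall fun ω => ?_)).trans_eq (by rw [probReal_univ, mul_one])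
  exact abs_truncated_generator_le (hZ.law_nonneg ht) (hZ.law_hasSum_one ht) hρ hρ1
    (thetaLaw_hasSum hZ.parameter_pos hZ.parameter_le_one (hZ.environment.mean_nonneg t ht)
      (hZ.environment.mean_le t ht) hρ hρ1) N (Z t.toNNReal ω)

/-- The function `G N`, pairing the forward state probabilities with the powers `(1 - x t) ^ n`, has
almost everywhere a derivative equal to the truncation defect times the rate. Hence `G N T - G N 0 →
0`, while the two terms converge to the two sides of the formula. -/
theorem integral_pow [IsProbabilityMeasure P] (hZ : IsThetaPositive P θ lam a Z) (T : ℝ≥0) {s : ℝ} (hs : 0 ≤ s)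
    (hs1 : s < 1) :
    ∫ ω, s ^ Z T ω ∂P = 1 - (bernoulliTerm θ lam a T +
      meanWeight θ lam a T * (1 - s) ^ (-θ)) ^ (-1 / θ) := by
  have henv := hZ.environment
  have hθ := hZ.parameter_pos
  have hT : (0 : ℝ) ≤ T := T.coe_nonneg
  have h1s : 0 < 1 - s := by linarith
  -- This constant is forced by the terminal condition `x T = 1 - s`.
  set C := bernoulliTerm θ lam a T + meanWeight θ lam a T * (1 - s) ^ (-θ) with hCdef
  have hw := meanWeight_pos θ lam a T
  have hC : bernoulliTerm θ lam a T + meanWeight θ lam a T ≤ C := by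
    have : 1 ≤ (1 - s) ^ (-θ) :=
      Real.one_le_rpow_of_pos_of_le_one_of_nonpos h1s (by linarith) (by linarith)
    rw [hCdef]; gcongr
    exact le_mul_of_one_le_right hw.le this
  set x := survivalSolution θ lam a C with hx
  have hxac := henv.absolutelyContinuous_survivalSolution hθ hT hC
  have hxmem : ∀ t : ℝ, 0 ≤ t → t ≤ T → x t ∈ Ioc 0 1 := fun t h0 h1 =>
    henv.survivalSolution_mem hθ hC h0 h1
  have hx0 : x 0 = C ^ (-1 / θ) := by
    simp [hx, survivalSolution, logMean, bernoulliTerm]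
  have hxT : x T = 1 - s := by
    rw [hx, survivalSolution, hCdef, add_sub_cancel_left, Real.mul_rpow hw.le (by positivity),
      ← Real.rpow_mul h1s.le, meanWeight, ← Real.exp_mul, ← mul_assoc, ← Real.exp_add,
      show -θ * (-1 / θ) = 1 by field_simp, Real.rpow_one,
      show -logMean lam a T + -θ * logMean lam a T * (-1 / θ) = 0 by field_simp; ring]
    simp
  -- The continuous positive function `x` has a positive minimum, so `1 - x ≤ r < 1` uniformly in
  -- time and the truncation error vanishes.
  obtain ⟨t₀, ht₀, hmin⟩ := isCompact_uIcc.exists_isMinOn (nonempty_uIcc (a := (0 : ℝ)) (b := T))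
    hxac.continuousOn
  rw [uIcc_of_le hT] at ht₀ hmin
  set r := 1 - x t₀ with hr
  have hr0 : 0 ≤ r := by linarith [(hxmem t₀ ht₀.1 ht₀.2).2]
  have hr1 : r < 1 := by linarith [(hxmem t₀ ht₀.1 ht₀.2).1]
  let G : ℕ → ℝ → ℝ := fun N t =>
    ∑ n ∈ Finset.range (N + 1), stateProb P θ lam a Z n t * (1 - x t) ^ n
  have hGac : ∀ N, AbsolutelyContinuousOnInterval (G N) 0 T := fun N =>
    absolutelyContinuousOnInterval_sum _ fun n _ =>
      (hZ.absolutelyContinuous_stateProb n hT).fun_mul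
        (absolutelyContinuousOnInterval_comp (f := fun y => (1 - y) ^ n) hxac
          ((contDiff_const.sub contDiff_id).pow n).contDiffOn)
  have hbound : ∀ N, |G N T - G N 0| ≤ (∫ t in (0 : ℝ)..T, lam t) * (((N : ℝ) + 1) * r ^ N) := by
    intro N
    rw [← (hGac N).integral_deriv_eq_sub, ← intervalIntegral.integral_mul_const, ← Real.norm_eq_abs]
    refine intervalIntegral.norm_integral_le_of_norm_le hT ?_
      ((henv.intervalIntegrable_rate le_rfl hT).mul_const _)
    filter_upwards [hZ.ae_hasDerivAt_stateProb hT, henv.ae_hasDerivAt_survivalSolution hθ hT hC]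
      with t hp hxd ht
    have htu : t ∈ uIcc (0 : ℝ) T := by rw [uIcc_of_le hT]; exact Ioc_subset_Icc_self ht
    have hd : HasDerivAt (G N) (∑ n ∈ Finset.range (N + 1),
        (lam t * expectedJump P θ a Z n t * (1 - x t) ^ n + stateProb P θ lam a Z n t *
          (n * (1 - x t) ^ (n - 1) *
            -(lam t * (thetaPGF θ (a t) (1 - x t) - (1 - x t)))))) t :=
      HasDerivAt.fun_sum fun n _ => (hp n htu).mul (((hxd htu).const_sub 1).pow n)
    have heq : ∑ n ∈ Finset.range (N + 1),
        (lam t * expectedJump P θ a Z n t * (1 - x t) ^ n + stateProb P θ lam a Z n t *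
          (n * (1 - x t) ^ (n - 1) *
            -(lam t * (thetaPGF θ (a t) (1 - x t) - (1 - x t))))) =
        lam t * ∑ n ∈ Finset.range (N + 1), (expectedJump P θ a Z n t * (1 - x t) ^ n -
          stateProb P θ lam a Z n t *
            (n * (1 - x t) ^ (n - 1) * (thetaPGF θ (a t) (1 - x t) - (1 - x t)))) := by
      rw [Finset.mul_sum]
      exact Finset.sum_congr rfl fun n _ => by ring
    have hm := hxmem t ht.1.le ht.2
    have hlam := henv.rate_nonneg t ht.1.le
    rw [hd.deriv, heq, norm_mul, Real.norm_of_nonneg hlam]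
    refine mul_le_mul_of_nonneg_left ?_ hlam
    refine (hZ.abs_truncated_derivative_le ht.1.le (by linarith [hm.2]) (by linarith [hm.1])
      N).trans ?_
    gcongr
    · linarith [hm.2]
    · have : x t₀ ≤ x t := hmin (Ioc_subset_Icc_self ht)
      linarith
  have hlim0 : Tendsto (fun N : ℕ => ((N : ℝ) + 1) * r ^ N) atTop (𝓝 0) := by
    have h1 := tendsto_self_mul_const_pow_of_lt_one hr0 hr1
    have h2 := tendsto_pow_atTop_nhds_zero_of_lt_one hr0 hr1
    simpa [add_mul] using h1.add h2
  have hdiff : Tendsto (fun N => G N T - G N 0) atTop (𝓝 0) := by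
    refine squeeze_zero_norm hbound ?_
    simpa using hlim0.const_mul (∫ t in (0 : ℝ)..T, lam t)
  have hGT : Tendsto (fun N => G N T) atTop (𝓝 (∫ ω, s ^ Z T ω ∂P)) := by
    have h := (hasSum_integral_comp (P := P) (hZ.measurable T) (f := fun n => s ^ n)
      (integrable_pow_comp (hZ.measurable T) hs hs1.le)).tendsto_sum_nat
    refine (h.comp (tendsto_add_atTop_nat 1)).congr fun N => ?_
    simp only [G, Function.comp_apply, hxT, hZ.stateProb_eq, sub_sub_cancel]
  have hG0 : Tendsto (fun N => G N 0) atTop (𝓝 (1 - C ^ (-1 / θ))) := by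
    refine tendsto_const_nhds.congr' ?_
    -- One initial individual leaves only the term `n = 1`, which belongs to the sum once `N ≥ 1`.
    filter_upwards [eventually_ge_atTop 1] with N hN
    simp only [G, hZ.stateProb_zero, hx0, ite_mul, one_mul, zero_mul]
    rw [Finset.sum_ite_eq' , if_pos (Finset.mem_range.2 (by lia)), pow_one]
  have := tendsto_nhds_unique hdiff (hGT.sub hG0)
  linarith

end IsThetaPositive

end VaryingBranching

/-! ### Mean, `V` and extinction probability from the generating function -/

namespace VaryingBranching

theorem meanWeight_rpow {θ : ℝ} (hθ : 0 < θ) (lam a : ℝ → ℝ) (t : ℝ) :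
    meanWeight θ lam a t ^ (-1 / θ) = Real.exp (logMean lam a t) := by
  rw [meanWeight, ← Real.exp_mul]; congr 1; field_simp

theorem exp_logMean_rpow (θ : ℝ) (lam a : ℝ → ℝ) (t : ℝ) :
    Real.exp (logMean lam a t) ^ (-θ) = meanWeight θ lam a t := by
  rw [meanWeight, ← Real.exp_mul, mul_comm]

variable {Ω : Type*} [MeasurableSpace Ω] {P : Measure Ω}
  {θ : ℝ} {lam a : ℝ → ℝ} {Z : ℝ≥0 → Ω → ℕ}

namespace IsThetaPositive

/-- The mean is the limit of the difference quotients `(1 - E((1 - x)^Z)) / x` as `x` decreases to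
zero. Written as geometric sums these quotients increase pointwise to `Z`, so monotone convergence
applies without prior integrability. -/
theorem meanSize_eq [IsProbabilityMeasure P] (hZ : IsThetaPositive P θ lam a Z) (t : ℝ≥0) :
    meanSize P Z t = ENNReal.ofReal (Real.exp (logMean lam a t)) := by
  have hθ := hZ.parameter_pos
  have hB := hZ.environment.bernoulliTerm_nonneg hθ t.coe_nonneg
  have hw := meanWeight_pos θ lam a t
  let x : ℕ → ℝ := fun k => 1 / ((k : ℝ) + 1)
  have hx0 : ∀ k, 0 < x k := fun k => by positivity
  have hx1 : ∀ k, x k ≤ 1 := fun k => by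
    rw [div_le_one (by positivity)]; linarith [(Nat.cast_nonneg k : (0 : ℝ) ≤ k)]
  have hxlim : Tendsto x atTop (𝓝 0) := tendsto_one_div_add_atTop_nhds_zero_nat
  have hxanti : Antitone x := fun i j hij => by
    simp only [x]; gcongr
  let f : ℕ → ℕ → ℝ := fun k n => ∑ i ∈ Finset.range n, (1 - x k) ^ i
  have hf0 : ∀ k n, 0 ≤ f k n := fun k n =>
    Finset.sum_nonneg fun i _ => pow_nonneg (by linarith [hx1 k]) i
  have hmono : ∀ n, Monotone fun k => f k n := fun n i j hij =>
    Finset.sum_le_sum fun l _ => pow_le_pow_left₀ (by linarith [hx1 i]) (by linarith [hxanti hij]) l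
  have hflim : ∀ n, Tendsto (fun k => f k n) atTop (𝓝 n) := fun n => by
    have : Tendsto (fun k => ∑ i ∈ Finset.range n, (1 - x k) ^ i) atTop
        (𝓝 (∑ i ∈ Finset.range n, (1 - 0) ^ i)) :=
      tendsto_finsetSum _ fun i _ => (hxlim.const_sub 1).pow i
    simpa using this
  have hfm : ∀ k, Measurable fun ω => ENNReal.ofReal (f k (Z t ω)) := fun k =>
    (measurable_from_top (f := fun n : ℕ => ENNReal.ofReal (f k n))).comp (hZ.measurable t)
  have hlim1 : Tendsto (fun k => ∫⁻ ω, ENNReal.ofReal (f k (Z t ω)) ∂P) atTop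
      (𝓝 (meanSize P Z t)) := by
    refine lintegral_tendsto_of_tendsto_of_monotone (fun k => (hfm k).aemeasurable)
      (Eventually.of_forall fun ω i j hij => ENNReal.ofReal_le_ofReal (hmono _ hij))
      (Eventually.of_forall fun ω => ?_)
    have := ENNReal.tendsto_ofReal (hflim (Z t ω))
    rwa [ENNReal.ofReal_natCast] at this
  have hval : ∀ k, ∫⁻ ω, ENNReal.ofReal (f k (Z t ω)) ∂P = ENNReal.ofReal
      ((bernoulliTerm θ lam a t * x k ^ θ + meanWeight θ lam a t) ^ (-1 / θ)) := fun k => by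
    have hgeom : ∀ n, f k n = (1 - (1 - x k) ^ n) * (x k)⁻¹ := fun n => by
      have := geom_sum_mul_neg (1 - x k) n
      rw [sub_sub_cancel] at this
      rw [← this, mul_inv_cancel_right₀ (hx0 k).ne']
    have hpi := integrable_pow_comp (P := P) (hZ.measurable t) (s := 1 - x k)
      (by linarith [hx1 k]) (by linarith [hx0 k])
    have hint : Integrable (fun ω => f k (Z t ω)) P := by
      simp only [hgeom]
      exact ((integrable_const 1).sub hpi).mul_const _
    rw [← ofReal_integral_eq_lintegral_ofReal hint (Eventually.of_forall fun ω => hf0 k _)]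
    simp only [hgeom]
    rw [integral_mul_const, integral_sub (integrable_const 1) hpi, integral_const, probReal_univ,
      one_smul, hZ.integral_pow t (by linarith [hx1 k]) (by linarith [hx0 k]), sub_sub_cancel,
      sub_sub_cancel]
    congr 1
    -- Extracting `x^{-θ}` produces, after the power `-1/θ`, a factor `x` that cancels the
    -- denominator of the quotient.
    have hfac : bernoulliTerm θ lam a t + meanWeight θ lam a t * x k ^ (-θ) =
        (bernoulliTerm θ lam a t * x k ^ θ + meanWeight θ lam a t) * x k ^ (-θ) := by
      rw [add_mul, mul_assoc, ← Real.rpow_add (hx0 k)]; simp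
    have hpos : 0 ≤ x k ^ θ := Real.rpow_nonneg (hx0 k).le θ
    rw [hfac, Real.mul_rpow (by positivity) (Real.rpow_nonneg (hx0 k).le _),
      ← Real.rpow_mul (hx0 k).le, show -θ * (-1 / θ) = 1 by field_simp, Real.rpow_one,
      mul_inv_cancel_right₀ (hx0 k).ne']
  simp only [hval] at hlim1
  refine tendsto_nhds_unique hlim1 (ENNReal.tendsto_ofReal ?_)
  have h1 : Tendsto (fun k => x k ^ θ) atTop (𝓝 0) := by
    have := hxlim.rpow_const (p := θ) (Or.inr hθ.le)
    rwa [Real.zero_rpow hθ.ne'] at this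
  have h2 : Tendsto (fun k => bernoulliTerm θ lam a t * x k ^ θ + meanWeight θ lam a t) atTop
      (𝓝 (meanWeight θ lam a t)) := by
    simpa using (h1.const_mul (bernoulliTerm θ lam a t)).add_const (meanWeight θ lam a t)
  have h3 := h2.rpow_const (p := -1 / θ) (Or.inl hw.ne')
  rwa [meanWeight_rpow hθ] at h3

theorem integrable_size [IsProbabilityMeasure P] (hZ : IsThetaPositive P θ lam a Z) (t : ℝ≥0) :
    Integrable (fun ω => (Z t ω : ℝ)) P := by
  refine ⟨(measurable_from_top.comp (hZ.measurable t)).aestronglyMeasurable, ?_⟩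
  have : ∫⁻ ω, ‖(Z t ω : ℝ)‖ₑ ∂P = meanSize P Z t := by
    refine lintegral_congr fun ω => ?_
    rw [Real.enorm_natCast]
  rw [HasFiniteIntegral, this, hZ.meanSize_eq]
  exact ENNReal.ofReal_lt_top

theorem integral_size [IsProbabilityMeasure P] (hZ : IsThetaPositive P θ lam a Z) (t : ℝ≥0) :
    ∫ ω, (Z t ω : ℝ) ∂P = Real.exp (logMean lam a t) := by
  rw [integral_eq_lintegral_of_nonneg_ae (Eventually.of_forall fun ω => Nat.cast_nonneg _)
    (hZ.integrable_size t).aestronglyMeasurable]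
  simp only [ENNReal.ofReal_natCast]
  change (meanSize P Z t).toReal = _
  rw [hZ.meanSize_eq, ENNReal.toReal_ofReal (Real.exp_pos _).le]

theorem intervalIntegrable_mul_meanWeight (hZ : IsThetaPositive P θ lam a Z) {s t : ℝ}
    (hs : 0 ≤ s) (hst : s ≤ t) :
    IntervalIntegrable (fun u => lam u * meanWeight θ lam a u) volume s t := by
  simpa using hZ.environment.intervalIntegrable_mul_meanWeight hZ.parameter_pos hs hst
    (g := fun _ => 1) measurable_const (C := 1) (by simp)

theorem thetaV_eq [IsProbabilityMeasure P] (hZ : IsThetaPositive P θ lam a Z) (t : ℝ≥0) :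
    thetaV P θ lam Z t = ENNReal.ofReal (θ * (1 + θ)⁻¹ *
      ∫ u in (0 : ℝ)..t, lam u * meanWeight θ lam a u) := by
  have hθ := hZ.parameter_pos
  rw [thetaV, ENNReal.ofReal_mul (p := θ * (1 + θ)⁻¹) (by positivity)]
  congr 1
  rw [intervalIntegral.integral_of_le t.coe_nonneg, ofReal_integral_eq_lintegral_ofReal]
  · refine setLIntegral_congr_fun measurableSet_Ioc fun u hu => ?_
    rw [hZ.meanSize_eq, Real.coe_toNNReal u hu.1.le, ENNReal.ofReal_rpow_of_pos (Real.exp_pos _),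
      exp_logMean_rpow, mul_comm, ← ENNReal.ofReal_mul (hZ.environment.rate_nonneg u hu.1.le)]
  · exact (intervalIntegrable_iff_integrableOn_Ioc_of_le t.coe_nonneg).1
      (hZ.intervalIntegrable_mul_meanWeight le_rfl t.coe_nonneg)
  · filter_upwards [ae_restrict_mem measurableSet_Ioc] with u hu
    exact mul_nonneg (hZ.environment.rate_nonneg u hu.1.le) (meanWeight_pos θ lam a u).le

/-- The generating function at `s = 0`, with the convention `0 ^ 0 = 1`. -/
theorem prob_extinct_eq [IsProbabilityMeasure P] (hZ : IsThetaPositive P θ lam a Z) (t : ℝ≥0) :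
    P {ω | Z t ω = 0} = ENNReal.ofReal
      (1 - (bernoulliTerm θ lam a t + meanWeight θ lam a t) ^ (-1 / θ)) := by
  have h := hZ.integral_pow t le_rfl zero_lt_one
  rw [sub_zero, Real.one_rpow, mul_one] at h
  have h1 : ∫ ω, (0 : ℝ) ^ Z t ω ∂P = P.real {ω | Z t ω = 0} := by
    have hm : MeasurableSet {ω | Z t ω = 0} := hZ.measurable t (measurableSet_singleton 0)
    rw [← integral_indicator_one hm]
    congr 1
    ext ω
    by_cases hω : Z t ω = 0
    · rw [indicator_of_mem (by exact hω), hω, pow_zero, Pi.one_apply]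
    · rw [indicator_of_notMem (by exact hω), zero_pow hω]
  rw [← h, h1, ofReal_measureReal]

theorem cumHazard_mono (hZ : IsThetaPositive P θ lam a Z) : Monotone (cumHazard lam) := by
  intro s t hst
  have hst' : (s : ℝ) ≤ t := hst
  rw [← sub_nonneg, cumHazard, cumHazard, intervalIntegral.integral_interval_sub_left
    (hZ.environment.intervalIntegrable_rate le_rfl t.coe_nonneg)
    (hZ.environment.intervalIntegrable_rate le_rfl s.coe_nonneg)]
  exact intervalIntegral.integral_nonneg hst' fun u hu =>
    hZ.environment.rate_nonneg u (s.coe_nonneg.trans hu.1)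

theorem cumHazard_sub (hZ : IsThetaPositive P θ lam a Z) (s t : ℝ≥0) :
    cumHazard lam t - cumHazard lam s = ∫ u in (s : ℝ)..t, lam u := by
  rw [cumHazard, cumHazard, intervalIntegral.integral_interval_sub_left
    (hZ.environment.intervalIntegrable_rate le_rfl t.coe_nonneg)
    (hZ.environment.intervalIntegrable_rate le_rfl s.coe_nonneg)]

end IsThetaPositive

end VaryingBranching

/-! ### Almost sure convergence -/

namespace VaryingBranching

/-- A right-continuous function with values in `ℕ` which is not constant on `[T, ∞)` takes a
different value on a dyadic grid starting from `T`. -/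
theorem exists_dyadic_ne {z : ℝ≥0 → ℕ} (hz : ∀ t, ContinuousWithinAt z (Ici t) t) {T t : ℝ≥0}
    (hTt : T ≤ t) (hne : z t ≠ z T) : ∃ k j : ℕ, z (T + j / 2 ^ k) ≠ z T := by
  let τ : ℕ → ℝ≥0 := fun k => T + ((⌊(t - T) * 2 ^ k⌋₊ + 1 : ℕ) : ℝ≥0) / 2 ^ k
  have hle : ∀ k, t ≤ τ k := fun k => by
    have h : t - T ≤ ((⌊(t - T) * 2 ^ k⌋₊ + 1 : ℕ) : ℝ≥0) / 2 ^ k := by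
      rw [le_div_iff₀ (by positivity)]
      push_cast
      exact (Nat.lt_floor_add_one _).le
    exact tsub_le_iff_left.1 h
  have hge : ∀ k, τ k ≤ t + (1 / 2) ^ k := fun k => by
    have h : ((⌊(t - T) * 2 ^ k⌋₊ + 1 : ℕ) : ℝ≥0) / 2 ^ k ≤ (t - T) + (1 / 2) ^ k := by
      rw [div_le_iff₀ (by positivity), add_mul, ← mul_pow]
      push_cast
      norm_num
      exact Nat.floor_le zero_le
    calc τ k ≤ T + ((t - T) + (1 / 2) ^ k) := add_le_add le_rfl h
      _ = t + (1 / 2) ^ k := by rw [← add_assoc, add_tsub_cancel_of_le hTt]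
  have hτ : Tendsto τ atTop (𝓝[≥] t) := by
    refine tendsto_nhdsWithin_iff.2 ⟨?_, Eventually.of_forall hle⟩
    refine tendsto_of_tendsto_of_tendsto_of_le_of_le tendsto_const_nhds ?_ hle hge
    have := (NNReal.tendsto_pow_atTop_nhds_zero_of_lt_one
      (show (1 / 2 : ℝ≥0) < 1 from NNReal.half_lt_self one_ne_zero)).const_add t
    simpa using this
  have h1 : Tendsto (fun k => z (τ k)) atTop (pure (z t)) := by
    rw [← nhds_discrete]; exact (hz t).tendsto.comp hτ
  obtain ⟨k, hk⟩ := (tendsto_pure.1 h1).exists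
  exact ⟨k, _, fun h => hne (hk.symm.trans h)⟩

variable {Ω : Type*} [MeasurableSpace Ω] {P : Measure Ω}
  {θ : ℝ} {lam a : ℝ → ℝ} {Z : ℝ≥0 → Ω → ℕ}

namespace IsThetaPositive

theorem sum_mul_stateProb_le [IsProbabilityMeasure P] (hZ : IsThetaPositive P θ lam a Z) (N : ℕ)
    {r : ℝ} (hr : 0 ≤ r) :
    ∑ n ∈ Finset.range N, n * stateProb P θ lam a Z n r ≤ Real.exp (logMean lam a r) := by
  have h := hasSum_integral_comp (hZ.measurable r.toNNReal) (f := fun n => (n : ℝ))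
    (hZ.integrable_size r.toNNReal)
  have h2 : ∀ n, stateProb P θ lam a Z n r = P.real (Z r.toNNReal ⁻¹' {n}) := fun n => by
    rw [← hZ.stateProb_eq, Real.coe_toNNReal r hr]
  have h3 := sum_le_hasSum (Finset.range N) (fun n _ => by positivity) h
  rw [hZ.integral_size, Real.coe_toNNReal r hr] at h3
  refine (Finset.sum_congr rfl fun n _ => ?_).trans_le h3
  rw [h2, mul_comm]

/-- The forward equation is applied on the past event `Z u = n`, where the probability of still
being in `n` can fall only through deaths in that state, at rate `n λ`. -/
theorem prob_leave_le [IsProbabilityMeasure P] (hZ : IsThetaPositive P θ lam a Z) {u v : ℝ≥0}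
    (huv : u ≤ v) (n : ℕ) :
    P.real (Z u ⁻¹' {n} \ Z v ⁻¹' {n}) ≤
      ∫ r in (u : ℝ)..v, lam r * (n * stateProb P θ lam a Z n r) := by
  have huv' : (u : ℝ) ≤ v := huv
  have hA : MeasurableSet[Filtration.natural Z hZ.branching.stronglyMeasurable u]
      (Z u ⁻¹' {n}) :=
    (Filtration.stronglyAdapted_natural hZ.branching.stronglyMeasurable u).measurable
      (measurableSet_singleton n)
  have hms : ∀ t, MeasurableSet (Z t ⁻¹' {n}) := fun t => hZ.measurable t (measurableSet_singleton n)
  have h := hZ.forward_equation huv hA n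
  rw [inter_self] at h
  have hd := measureReal_sdiff_add_inter (μ := P) (s := Z u ⁻¹' {n}) (hms v)
  have hle : P.real (Z u ⁻¹' {n} \ Z v ⁻¹' {n}) = ∫ r in (u : ℝ)..v, -(lam r *
      ∫ ω in Z u ⁻¹' {n}, jumpKernel (thetaLaw θ (a r)) n (Z r.toNNReal ω) ∂P) := by
    rw [intervalIntegral.integral_neg]; linarith
  rw [hle]
  have hsub : uIcc (u : ℝ) v ⊆ uIcc 0 v := by
    rw [uIcc_of_le huv', uIcc_of_le v.coe_nonneg]; exact Icc_subset_Icc_left u.coe_nonneg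
  refine intervalIntegral.integral_mono_on huv' ?_ ?_ fun r hr => ?_
  · refine (hZ.environment.intervalIntegrable_rate_mul u.coe_nonneg v.coe_nonneg (C := n + 1) ?_
      fun r hr => ?_).neg
    · exact ((hZ.measurable_jumpKernel_uncurry n).stronglyMeasurable.integral_prod_right'
        (ν := P.restrict (Z u ⁻¹' {n}))).aestronglyMeasurable
    · have hr0 : 0 ≤ r := (le_min u.coe_nonneg v.coe_nonneg).trans hr.1.le
      have hb : ∀ ω ∈ Z u ⁻¹' {n}, ‖jumpKernel (thetaLaw θ (a r)) n (Z r.toNNReal ω)‖ ≤ n + 1 :=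
        fun ω _ => hZ.abs_jumpKernel_le hr0 n _
      refine (norm_setIntegral_le_of_norm_le_const (measure_lt_top P _) hb).trans ?_
      exact mul_le_of_le_one_right (by positivity) measureReal_le_one
  · refine (hZ.environment.intervalIntegrable_rate u.coe_nonneg v.coe_nonneg).mul_continuousOn ?_
    exact continuousOn_const.mul
      ((hZ.absolutelyContinuous_stateProb n v.coe_nonneg).continuousOn.mono hsub)
  · have hr0 : 0 ≤ r := u.coe_nonneg.trans hr.1
    rw [← mul_neg]
    refine mul_le_mul_of_nonneg_left ?_ (hZ.environment.rate_nonneg r hr0)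
    have hp : stateProb P θ lam a Z n r = P.real (Z r.toNNReal ⁻¹' {n}) := by
      rw [← hZ.stateProb_eq, Real.coe_toNNReal r hr0]
    have hlow : ∀ ω, -((n : ℝ) * (Z r.toNNReal ⁻¹' {n}).indicator 1 ω) ≤
        jumpKernel (thetaLaw θ (a r)) n (Z r.toNNReal ω) := fun ω => by
      refine le_trans (le_of_eq ?_) (neg_le_jumpKernel (hZ.law_nonneg hr0) n _)
      by_cases hω : Z r.toNNReal ω = n
      · rw [if_pos hω, indicator_of_mem (by simpa using hω), Pi.one_apply]
      · rw [if_neg hω, indicator_of_notMem (by simpa using hω)]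
    have hindint : Integrable ((Z r.toNNReal ⁻¹' {n}).indicator (1 : Ω → ℝ)) P :=
      (integrable_const 1).indicator (hms _)
    have h1 := setIntegral_mono (s := Z u ⁻¹' {n}) (hindint.const_mul (n : ℝ)).neg.integrableOn
      (hZ.integrable_jumpKernel n hr0).integrableOn hlow
    have h2 : ∫ ω in Z u ⁻¹' {n}, (-((n : ℝ) * (Z r.toNNReal ⁻¹' {n}).indicator 1 ω)) ∂P =
        -(n * P.real (Z r.toNNReal ⁻¹' {n} ∩ Z u ⁻¹' {n})) := by
      rw [integral_neg, integral_const_mul, integral_indicator_one (hms _),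
        measureReal_restrict_apply (hms _)]
    have h3 : P.real (Z r.toNNReal ⁻¹' {n} ∩ Z u ⁻¹' {n}) ≤ P.real (Z r.toNNReal ⁻¹' {n}) :=
      measureReal_mono inter_subset_left
    have h4 := mul_le_mul_of_nonneg_left h3 (Nat.cast_nonneg (α := ℝ) n)
    rw [hp]
    have h5 := h2.symm.trans_le h1
    linarith

/-- Summed over the starting state, the departure rates are `λ` times the mean, so the bound is in
effect the expected number of deaths in the interval. -/
theorem prob_ne_le [IsProbabilityMeasure P] (hZ : IsThetaPositive P θ lam a Z) {M : ℝ}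
    (hM : ∀ t, 0 ≤ t → Real.exp (logMean lam a t) ≤ M) {u v : ℝ≥0} (huv : u ≤ v) :
    P {ω | Z u ω ≠ Z v ω} ≤ ENNReal.ofReal (M * (cumHazard lam v - cumHazard lam u)) := by
  have huv' : (u : ℝ) ≤ v := huv
  have hsub : uIcc (u : ℝ) v ⊆ uIcc 0 v := by
    rw [uIcc_of_le huv', uIcc_of_le v.coe_nonneg]; exact Icc_subset_Icc_left u.coe_nonneg
  have hcover : {ω | Z u ω ≠ Z v ω} ⊆ ⋃ n, Z u ⁻¹' {n} \ Z v ⁻¹' {n} := fun ω hω =>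
    mem_iUnion.2 ⟨Z u ω, rfl, fun h => hω (Eq.symm h)⟩
  refine (measure_mono hcover).trans ((measure_iUnion_le _).trans ?_)
  refine ENNReal.tsum_le_of_sum_range_le fun N => ?_
  have h1 : ∑ n ∈ Finset.range N, P (Z u ⁻¹' {n} \ Z v ⁻¹' {n}) =
      ENNReal.ofReal (∑ n ∈ Finset.range N, P.real (Z u ⁻¹' {n} \ Z v ⁻¹' {n})) := by
    rw [ENNReal.ofReal_sum_of_nonneg fun n _ => measureReal_nonneg]
    exact Finset.sum_congr rfl fun n _ => by rw [ofReal_measureReal]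
  rw [h1]
  refine ENNReal.ofReal_le_ofReal ?_
  have hI : ∀ n, IntervalIntegrable (fun r => lam r * (n * stateProb P θ lam a Z n r))
      volume u v := fun n =>
    (hZ.environment.intervalIntegrable_rate u.coe_nonneg v.coe_nonneg).mul_continuousOn
      (continuousOn_const.mul
        ((hZ.absolutelyContinuous_stateProb n v.coe_nonneg).continuousOn.mono hsub))
  calc ∑ n ∈ Finset.range N, P.real (Z u ⁻¹' {n} \ Z v ⁻¹' {n})
      ≤ ∑ n ∈ Finset.range N, ∫ r in (u : ℝ)..v, lam r * (n * stateProb P θ lam a Z n r) :=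
        Finset.sum_le_sum fun n _ => hZ.prob_leave_le huv n
    _ = ∫ r in (u : ℝ)..v, ∑ n ∈ Finset.range N, lam r * (n * stateProb P θ lam a Z n r) :=
        (intervalIntegral.integral_finsetSum fun n _ => hI n).symm
    _ ≤ ∫ r in (u : ℝ)..v, M * lam r := by
        refine intervalIntegral.integral_mono_on huv' ?_
          ((hZ.environment.intervalIntegrable_rate u.coe_nonneg v.coe_nonneg).const_mul M)
          fun r hr => ?_
        · have heq : (fun r => ∑ n ∈ Finset.range N, lam r * (n * stateProb P θ lam a Z n r)) =
              ∑ n ∈ Finset.range N, fun r => lam r * (n * stateProb P θ lam a Z n r) := by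
            ext r
            rw [Finset.sum_apply]
          rw [heq]
          exact IntervalIntegrable.sum (Finset.range N) (fun n _ => hI n)
        · have hr0 : 0 ≤ r := u.coe_nonneg.trans hr.1
          rw [← Finset.mul_sum, mul_comm M]
          exact mul_le_mul_of_nonneg_left ((hZ.sum_mul_stateProb_le N hr0).trans (hM r hr0))
            (hZ.environment.rate_nonneg r hr0)
    _ = M * (cumHazard lam v - cumHazard lam u) := by
        rw [intervalIntegral.integral_const_mul, hZ.cumHazard_sub]

/-- On each dyadic grid the increments of the cumulative hazard telescope, with a bound independent
of the mesh. The grids are nested, so the bound passes to the increasing union, and right continuity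
makes the union detect every change. -/
theorem prob_not_constant_le [IsProbabilityMeasure P] (hZ : IsThetaPositive P θ lam a Z) {M L : ℝ}
    (hM : ∀ t, 0 ≤ t → Real.exp (logMean lam a t) ≤ M) (hL : ∀ t, cumHazard lam t ≤ L) (T : ℝ≥0) :
    P {ω | ∃ t, T ≤ t ∧ Z t ω ≠ Z T ω} ≤ ENNReal.ofReal (M * (L - cumHazard lam T)) := by
  have hM0 : 0 ≤ M := (Real.exp_pos _).le.trans (hM 0 le_rfl)
  let E : ℕ → Set Ω := fun k => {ω | ∃ j : ℕ, Z (T + j / 2 ^ k) ω ≠ Z T ω}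
  have hsub : {ω | ∃ t, T ≤ t ∧ Z t ω ≠ Z T ω} ⊆ ⋃ k, E k := by
    rintro ω ⟨t, hTt, hne⟩
    obtain ⟨k, j, h⟩ := exists_dyadic_ne (hZ.branching.right_continuous ω) hTt hne
    exact mem_iUnion.2 ⟨k, j, h⟩
  have hmono : Monotone E := by
    refine monotone_nat_of_le_succ fun k ω => ?_
    rintro ⟨j, hj⟩
    refine ⟨2 * j, ?_⟩
    have : ((2 * j : ℕ) : ℝ≥0) / 2 ^ (k + 1) = j / 2 ^ k := by
      rw [pow_succ]; push_cast; field_simp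
    rwa [this]
  refine (measure_mono hsub).trans ?_
  rw [hmono.measure_iUnion]
  refine iSup_le fun k => ?_
  let g : ℕ → ℝ≥0 := fun j => T + j / 2 ^ k
  have hg : Monotone g := fun i j hij => by
    simp only [g]; gcongr
  have hg0 : g 0 = T := by simp [g]
  have hcover : E k ⊆ ⋃ j, {ω | Z (g j) ω ≠ Z (g (j + 1)) ω} := by
    rintro ω ⟨j, hj⟩
    by_contra hcon
    simp only [mem_iUnion, mem_ofPred_eq, not_exists, not_not] at hcon
    have : ∀ i, Z (g i) ω = Z T ω := fun i => by
      induction i with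
      | zero => rw [hg0]
      | succ i ih => rw [← hcon i, ih]
    exact hj (this j)
  refine (measure_mono hcover).trans ((measure_iUnion_le _).trans ?_)
  refine ENNReal.tsum_le_of_sum_range_le fun N => ?_
  refine (Finset.sum_le_sum fun j _ => hZ.prob_ne_le hM (hg (Nat.le_succ j))).trans ?_
  rw [← ENNReal.ofReal_sum_of_nonneg fun j _ =>
    mul_nonneg hM0 (sub_nonneg.2 (hZ.cumHazard_mono (hg (Nat.le_succ j)))), ← Finset.mul_sum]
  refine ENNReal.ofReal_le_ofReal (mul_le_mul_of_nonneg_left ?_ hM0)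
  have := Finset.sum_range_sub (fun j => cumHazard lam (g j)) N
  rw [this, hg0]
  linarith [hL (g N)]

theorem ae_eventually_constant [IsProbabilityMeasure P] (hZ : IsThetaPositive P θ lam a Z)
    {M L : ℝ} (hM : ∀ t, 0 ≤ t → Real.exp (logMean lam a t) ≤ M)
    (hL : Tendsto (cumHazard lam) atTop (𝓝 L)) :
    ∀ᵐ ω ∂P, ∃ l, Tendsto (fun t => Z t ω) atTop (𝓝 l) := by
  have hLle : ∀ t, cumHazard lam t ≤ L := hZ.cumHazard_mono.ge_of_tendsto hL
  have hzero : P (⋂ T : ℕ, {ω | ∃ t, (T : ℝ≥0) ≤ t ∧ Z t ω ≠ Z T ω}) = 0 := by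
    have hlim : Tendsto (fun T : ℕ => ENNReal.ofReal (M * (L - cumHazard lam T))) atTop (𝓝 0) := by
      have h1 := (hL.comp tendsto_natCast_atTop_atTop).const_sub L
      have h2 := ENNReal.tendsto_ofReal (h1.const_mul M)
      simpa using h2
    refine le_antisymm (ge_of_tendsto' hlim fun T => ?_) zero_le
    exact (measure_mono (iInter_subset _ T)).trans (hZ.prob_not_constant_le hM hLle T)
  filter_upwards [measure_eq_zero_iff_ae_notMem.1 hzero] with ω hω
  simp only [mem_iInter, mem_ofPred_eq, not_forall, not_exists, not_and, not_not] at hω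
  obtain ⟨T, hT⟩ := hω
  refine ⟨Z T ω, tendsto_const_nhds.congr' ?_⟩
  filter_upwards [eventually_ge_atTop (T : ℝ≥0)] with t ht
  exact (hT t ht).symm

end IsThetaPositive

end VaryingBranching

/-! ### Limits of the environment and the equivalence with finite total hazard -/

namespace VaryingBranching

variable {Ω : Type*} [MeasurableSpace Ω] {P : Measure Ω}
  {θ : ℝ} {lam a : ℝ → ℝ} {Z : ℝ≥0 → Ω → ℕ}

namespace IsThetaPositive

theorem abs_logMean_le (hZ : IsThetaPositive P θ lam a Z) {L : ℝ}
    (hL : ∀ t, cumHazard lam t ≤ L) {t : ℝ} (ht : 0 ≤ t) :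
    |logMean lam a t| ≤ L * (1 + 1 / θ) := by
  have hθ := hZ.parameter_pos
  have henv := hZ.environment
  have h1 : |logMean lam a t| ≤ ∫ u in (0 : ℝ)..t, lam u * (1 + 1 / θ) := by
    rw [← Real.norm_eq_abs]
    refine intervalIntegral.norm_integral_le_of_norm_le ht (Eventually.of_forall fun u hu => ?_)
      ((henv.intervalIntegrable_rate le_rfl ht).mul_const _)
    rw [norm_mul, Real.norm_of_nonneg (henv.rate_nonneg u hu.1.le)]
    exact mul_le_mul_of_nonneg_left (henv.abs_mean_sub_one_le hθ hu.1.le)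
      (henv.rate_nonneg u hu.1.le)
  rw [intervalIntegral.integral_mul_const] at h1
  refine h1.trans ?_
  have h2 := hL t.toNNReal
  rw [cumHazard, Real.coe_toNNReal t ht] at h2
  gcongr

theorem integrableOn_rate (hZ : IsThetaPositive P θ lam a Z) {L : ℝ}
    (hL : ∀ t, cumHazard lam t ≤ L) : IntegrableOn lam (Ioi 0) := by
  refine integrableOn_Ioi_of_intervalIntegral_norm_bounded (l := atTop) (b := fun t : ℝ≥0 => (t : ℝ))
    L 0 (fun t => hZ.environment.integrable_rate t t.coe_nonneg)
    (NNReal.tendsto_coe_atTop.2 tendsto_id) (Eventually.of_forall fun t => ?_)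
  refine le_trans (le_of_eq ?_) (hL t)
  refine intervalIntegral.integral_congr fun u hu => ?_
  rw [uIcc_of_le t.coe_nonneg] at hu
  exact Real.norm_of_nonneg (hZ.environment.rate_nonneg u hu.1)

theorem exists_tendsto_logMean (hZ : IsThetaPositive P θ lam a Z) {L : ℝ}
    (hL : ∀ t, cumHazard lam t ≤ L) :
    ∃ e, Tendsto (fun t : ℝ≥0 => logMean lam a t) atTop (𝓝 e) := by
  refine ⟨_, intervalIntegral_tendsto_integral_Ioi 0 ?_ (NNReal.tendsto_coe_atTop.2 tendsto_id)⟩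
  refine Integrable.mul_bdd (c := 1 + 1 / θ) (hZ.integrableOn_rate hL)
    (hZ.environment.measurable_mean.sub_const 1).aestronglyMeasurable ?_
  filter_upwards [ae_restrict_mem measurableSet_Ioi] with u hu
  exact hZ.environment.abs_mean_sub_one_le hZ.parameter_pos (le_of_lt hu)

theorem exists_tendsto_integral_meanWeight (hZ : IsThetaPositive P θ lam a Z) {L : ℝ}
    (hL : ∀ t, cumHazard lam t ≤ L) :
    ∃ v, 0 ≤ v ∧
      Tendsto (fun t : ℝ≥0 => ∫ u in (0 : ℝ)..t, lam u * meanWeight θ lam a u) atTop (𝓝 v) := by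
  have hθ := hZ.parameter_pos
  have hlim := intervalIntegral_tendsto_integral_Ioi (l := atTop) (b := fun t : ℝ≥0 => (t : ℝ))
    (f := fun u => lam u * meanWeight θ lam a u) (μ := volume) 0 ?_
    (NNReal.tendsto_coe_atTop.2 tendsto_id)
  · refine ⟨_, ge_of_tendsto' hlim fun t => ?_, hlim⟩
    exact intervalIntegral.integral_nonneg t.coe_nonneg fun u hu =>
      mul_nonneg (hZ.environment.rate_nonneg u hu.1) (meanWeight_pos θ lam a u).le
  · refine Integrable.mul_bdd (c := Real.exp (θ * (L * (1 + 1 / θ)))) (hZ.integrableOn_rate hL)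
      ?_ ?_
    · have hc : ContinuousOn (meanWeight θ lam a) (Ioi 0) := fun u hu => by
        have hu' : (0 : ℝ) < u := hu
        have h1 := (hZ.environment.absolutelyContinuous_meanWeight hθ
          (t := u + 1) (by linarith)).continuousOn
        rw [uIcc_of_le (by linarith)] at h1
        exact (h1.continuousAt (Icc_mem_nhds hu' (by linarith))).continuousWithinAt
      exact hc.aestronglyMeasurable measurableSet_Ioi
    · filter_upwards [ae_restrict_mem measurableSet_Ioi] with u hu
      have h2 := abs_le.1 (hZ.abs_logMean_le hL (le_of_lt hu))
      rw [Real.norm_of_nonneg (meanWeight_pos θ lam a u).le, meanWeight, Real.exp_le_exp]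
      nlinarith [h2.1]

theorem tendsto_meanWeight {e : ℝ}
    (he : Tendsto (fun t : ℝ≥0 => logMean lam a t) atTop (𝓝 e)) :
    Tendsto (fun t : ℝ≥0 => meanWeight θ lam a t) atTop (𝓝 (Real.exp e ^ (-θ))) := by
  have h := (Real.continuous_exp.tendsto _).comp (he.const_mul (-θ))
  rw [← Real.exp_mul, mul_comm]
  exact h

theorem tendsto_bernoulliTerm (hZ : IsThetaPositive P θ lam a Z) {e v : ℝ}
    (he : Tendsto (fun t : ℝ≥0 => logMean lam a t) atTop (𝓝 e))
    (hv : Tendsto (fun t : ℝ≥0 => ∫ u in (0 : ℝ)..t, lam u * meanWeight θ lam a u) atTop (𝓝 v)) :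
    Tendsto (fun t : ℝ≥0 => bernoulliTerm θ lam a t) atTop
      (𝓝 (θ * (1 + θ)⁻¹ * v + (1 + θ)⁻¹ * (1 - Real.exp e ^ (-θ)))) := by
  refine ((hv.const_mul _).add (((tendsto_meanWeight he).const_sub 1).const_mul _)).congr fun t => ?_
  exact (hZ.environment.bernoulliTerm_eq hZ.parameter_pos t.coe_nonneg).symm

theorem one_le_bernoulliTerm_add (hZ : IsThetaPositive P θ lam a Z) (t : ℝ≥0) :
    1 ≤ bernoulliTerm θ lam a t + meanWeight θ lam a t := by
  have h := hZ.environment.bernoulliTerm_add_meanWeight_mono hZ.parameter_pos le_rfl t.coe_nonneg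
  simpa [bernoulliTerm, meanWeight, logMean] using h

theorem tendsto_meanSize [IsProbabilityMeasure P] (hZ : IsThetaPositive P θ lam a Z) {e : ℝ}
    (he : Tendsto (fun t : ℝ≥0 => logMean lam a t) atTop (𝓝 e)) :
    Tendsto (meanSize P Z) atTop (𝓝 (ENNReal.ofReal (Real.exp e))) :=
  (ENNReal.tendsto_ofReal ((Real.continuous_exp.tendsto _).comp he)).congr fun t =>
    (hZ.meanSize_eq t).symm

theorem isAsymptoticallyDegenerate [IsProbabilityMeasure P] (hZ : IsThetaPositive P θ lam a Z)
    {L : ℝ} (hL : Tendsto (cumHazard lam) atTop (𝓝 L)) : IsAsymptoticallyDegenerate P Z := by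
  have hLle := hZ.cumHazard_mono.ge_of_tendsto hL
  obtain ⟨e, he⟩ := hZ.exists_tendsto_logMean hLle
  obtain ⟨v, -, hv⟩ := hZ.exists_tendsto_integral_meanWeight hLle
  have hD := (hZ.tendsto_bernoulliTerm he hv).add (tendsto_meanWeight (θ := θ) he)
  set D := θ * (1 + θ)⁻¹ * v + (1 + θ)⁻¹ * (1 - Real.exp e ^ (-θ)) + Real.exp e ^ (-θ)
  have hD1 : 1 ≤ D := ge_of_tendsto' hD hZ.one_le_bernoulliTerm_add
  have hD0 : 0 < D := one_pos.trans_le hD1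
  refine ⟨⟨ENNReal.ofReal (1 - D ^ (-1 / θ)), ?_, ?_⟩, ?_⟩
  · simp only [hZ.prob_extinct_eq]
    exact ENNReal.tendsto_ofReal ((hD.rpow_const (Or.inl hD0.ne')).const_sub 1)
  · rw [ENNReal.ofReal_lt_one]
    linarith [Real.rpow_pos_of_pos hD0 (-1 / θ)]
  · rw [(hZ.tendsto_meanSize he).liminf_eq]
    exact ENNReal.ofReal_lt_top

/-- Extinction probabilities increase to `q`, so each is at most `q`; solving this inequality for `B
+ w` gives a bound that is uniform in `t`. -/
theorem bernoulliTerm_add_meanWeight_le [IsProbabilityMeasure P]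
    (hZ : IsThetaPositive P θ lam a Z) {q : ℝ≥0∞}
    (hq : Tendsto (fun t => P {ω | Z t ω = 0}) atTop (𝓝 q)) (hq1 : q < 1) (t : ℝ≥0) :
    bernoulliTerm θ lam a t + meanWeight θ lam a t ≤ (1 - q.toReal) ^ (-θ) := by
  have hθ := hZ.parameter_pos
  have hpos := fun t => one_pos.trans_le (hZ.one_le_bernoulliTerm_add t)
  have hmono : Monotone fun t => P {ω | Z t ω = 0} := by
    intro s t hst
    simp only [hZ.prob_extinct_eq]
    refine ENNReal.ofReal_le_ofReal (sub_le_sub_left ?_ 1)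
    exact Real.rpow_le_rpow_of_nonpos (hpos s)
      (hZ.environment.bernoulliTerm_add_meanWeight_mono hθ s.coe_nonneg hst)
      (by rw [neg_div]; simpa using hθ.le)
  have h1 := hmono.ge_of_tendsto hq t
  simp only [hZ.prob_extinct_eq] at h1
  rw [ENNReal.ofReal_le_iff_le_toReal (hq1.trans ENNReal.one_lt_top).ne] at h1
  have h2 : q.toReal < 1 := by
    rw [← ENNReal.toReal_one]; exact ENNReal.toReal_strict_mono ENNReal.one_ne_top hq1
  have h3 : 1 - q.toReal ≤ (bernoulliTerm θ lam a t + meanWeight θ lam a t) ^ (-1 / θ) := by linarith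
  have h4 := Real.rpow_le_rpow_of_nonpos (by linarith) h3 (neg_nonpos.2 hθ.le)
  rwa [← Real.rpow_mul (hpos t).le, show -1 / θ * -θ = 1 by field_simp, Real.rpow_one] at h4

theorem exists_tendsto_cumHazard [IsProbabilityMeasure P] (hZ : IsThetaPositive P θ lam a Z)
    (hdeg : IsAsymptoticallyDegenerate P Z) : ∃ L : ℝ, Tendsto (cumHazard lam) atTop (𝓝 L) := by
  obtain ⟨⟨q, hq, hq1⟩, hinf⟩ := hdeg
  have hθ := hZ.parameter_pos
  have henv := hZ.environment
  set K := (1 - q.toReal) ^ (-θ)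
  have hK := hZ.bernoulliTerm_add_meanWeight_le hq hq1
  let W : ℝ≥0 → ℝ := fun t => ∫ u in (0 : ℝ)..t, lam u * meanWeight θ lam a u
  have hWsub : ∀ s t : ℝ≥0, W t - W s = ∫ u in (s : ℝ)..t, lam u * meanWeight θ lam a u :=
    fun s t => intervalIntegral.integral_interval_sub_left
      (hZ.intervalIntegrable_mul_meanWeight le_rfl t.coe_nonneg)
      (hZ.intervalIntegrable_mul_meanWeight le_rfl s.coe_nonneg)
  have hWmono : Monotone W := fun s t hst => by
    rw [← sub_nonneg, hWsub]
    exact intervalIntegral.integral_nonneg hst fun u hu => mul_nonneg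
      (henv.rate_nonneg u (s.coe_nonneg.trans hu.1)) (meanWeight_pos θ lam a u).le
  -- Both varying terms on the right are nonnegative. A bound on the left therefore bounds `W`, and
  -- convergence of the left side and of `W` forces convergence of `w`.
  have hdecomp : ∀ t : ℝ≥0, bernoulliTerm θ lam a t + meanWeight θ lam a t =
      θ * (1 + θ)⁻¹ * W t + (1 + θ)⁻¹ + θ * (1 + θ)⁻¹ * meanWeight θ lam a t := fun t => by
    rw [henv.bernoulliTerm_eq hθ t.coe_nonneg]
    simp only [W]
    field_simp
    ring
  have hc : 0 < θ * (1 + θ)⁻¹ := by positivity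
  have hWle : ∀ t, W t ≤ K / (θ * (1 + θ)⁻¹) := fun t => by
    rw [le_div_iff₀ hc]
    have h1 := hK t
    rw [hdecomp] at h1
    have := mul_pos hc (meanWeight_pos θ lam a t)
    have : 0 < (1 + θ)⁻¹ := by positivity
    linarith
  have hWlim := tendsto_atTop_ciSup hWmono ⟨_, forall_mem_range.2 hWle⟩
  have hDmono : Monotone fun t : ℝ≥0 => bernoulliTerm θ lam a t + meanWeight θ lam a t :=
    fun s t hst => henv.bernoulliTerm_add_meanWeight_mono hθ s.coe_nonneg hst
  have hDlim := tendsto_atTop_ciSup hDmono ⟨K, forall_mem_range.2 hK⟩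
  set w := (θ * (1 + θ)⁻¹)⁻¹ * ((⨆ t : ℝ≥0, (bernoulliTerm θ lam a t + meanWeight θ lam a t)) -
    (1 + θ)⁻¹) - ⨆ t, W t
  have hwlim : Tendsto (fun t : ℝ≥0 => meanWeight θ lam a t) atTop (𝓝 w) := by
    refine (((hDlim.sub_const _).const_mul _).sub hWlim).congr fun t => ?_
    simp only [hdecomp]
    field_simp
    ring
  obtain ⟨m, hm, hm_lt⟩ := exists_between hinf
  have hfreq := frequently_lt_of_liminf_lt (by isBoundedDefault) hm
  -- The finite lower limit puts the mean below `m` at arbitrarily late times, where the weight is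
  -- at least `m^{-θ}`; since the weight converges, so is its limit.
  have hwpos : 0 < w := by
    have hm0 : 0 < m.toReal := by
      obtain ⟨t, ht⟩ := hfreq.exists
      exact ENNReal.toReal_pos (pos_of_gt ht).ne' hm_lt.ne
    refine (Real.rpow_pos_of_pos hm0 (-θ)).trans_le
      (ge_of_tendsto_of_frequently hwlim (hfreq.mono fun t ht => ?_))
    rw [hZ.meanSize_eq] at ht
    have h1 := (ENNReal.ofReal_le_iff_le_toReal hm_lt.ne).1 ht.le
    rw [← exp_logMean_rpow]
    exact Real.rpow_le_rpow_of_nonpos (Real.exp_pos _) h1 (neg_nonpos.2 hθ.le)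
  -- After `T` the weight exceeds `w / 2`, so increments of the hazard are controlled by those of
  -- the bounded function `W`.
  obtain ⟨T, hT⟩ := eventually_atTop.1 (hwlim.eventually (lt_mem_nhds (half_lt_self hwpos)))
  have hbound : ∀ t, cumHazard lam t ≤
      cumHazard lam T + (w / 2)⁻¹ * (K / (θ * (1 + θ)⁻¹) - W T) := by
    intro t
    refine (hZ.cumHazard_mono (le_max_left t T)).trans ?_
    have hTt : T ≤ max t T := le_max_right t T
    generalize max t T = r at hTt
    have hTr : (T : ℝ) ≤ r := hTt
    have h1 : w / 2 * (cumHazard lam r - cumHazard lam T) ≤ W r - W T := by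
      rw [hZ.cumHazard_sub, hWsub, ← intervalIntegral.integral_const_mul]
      refine intervalIntegral.integral_mono_on hTr
        ((henv.intervalIntegrable_rate T.coe_nonneg r.coe_nonneg).const_mul _)
        (hZ.intervalIntegrable_mul_meanWeight T.coe_nonneg hTr) fun u hu => ?_
      have hu0 : 0 ≤ u := T.coe_nonneg.trans hu.1
      have h2 := hT u.toNNReal (NNReal.le_toNNReal_of_coe_le hu.1)
      rw [Real.coe_toNNReal u hu0] at h2
      rw [mul_comm]
      exact mul_le_mul_of_nonneg_left h2.le (henv.rate_nonneg u hu0)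
    have h3 : cumHazard lam r - cumHazard lam T ≤ (w / 2)⁻¹ * (W r - W T) := by
      rw [← div_eq_inv_mul, le_div_iff₀ (by positivity), mul_comm]; exact h1
    have h4 : (w / 2)⁻¹ * (W r - W T) ≤ (w / 2)⁻¹ * (K / (θ * (1 + θ)⁻¹) - W T) := by
      gcongr; exact hWle r
    linarith
  exact ⟨_, tendsto_atTop_ciSup hZ.cumHazard_mono ⟨_, forall_mem_range.2 hbound⟩⟩

end IsThetaPositive

end VaryingBranching

theorem theorem3 {Ω : Type*} [MeasurableSpace Ω] (P : Measure Ω) [IsProbabilityMeasure P]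
    (θ : ℝ) (lam a : ℝ → ℝ) (Z : ℝ≥0 → Ω → ℕ)
    (hZ : VaryingBranching.IsThetaPositive P θ lam a Z) :
    (VaryingBranching.IsAsymptoticallyDegenerate P Z ↔
      ∃ L : ℝ, Tendsto (VaryingBranching.cumHazard lam) atTop (𝓝 L)) ∧
    (VaryingBranching.IsAsymptoticallyDegenerate P Z →
      ∃ μ V : ℝ≥0, 0 < μ ∧
        Tendsto (VaryingBranching.meanSize P Z) atTop (𝓝 (μ : ℝ≥0∞)) ∧
        Tendsto (VaryingBranching.thetaV P θ lam Z) atTop (𝓝 (V : ℝ≥0∞)) ∧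
        ∃ Zinf : Ω → ℕ, Measurable Zinf ∧
          (∀ᵐ ω ∂P, Tendsto (fun t => Z t ω) atTop (𝓝 (Zinf ω))) ∧
          ∀ s : ℝ, 0 ≤ s → s < 1 →
            ∫ ω, s ^ (Zinf ω) ∂P =
              1 - ((V : ℝ) + (1 + θ)⁻¹ * (1 - (μ : ℝ) ^ (-θ))
                + (μ : ℝ) ^ (-θ) * (1 - s) ^ (-θ)) ^ (-1 / θ)) := by
  refine ⟨⟨hZ.exists_tendsto_cumHazard, fun ⟨L, hL⟩ => hZ.isAsymptoticallyDegenerate hL⟩,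
    fun hdeg => ?_⟩
  obtain ⟨L, hL⟩ := hZ.exists_tendsto_cumHazard hdeg
  have hθ := hZ.parameter_pos
  have hLle := hZ.cumHazard_mono.ge_of_tendsto hL
  obtain ⟨e, he⟩ := hZ.exists_tendsto_logMean hLle
  obtain ⟨v, hv0, hv⟩ := hZ.exists_tendsto_integral_meanWeight hLle
  have hV0 : 0 ≤ θ * (1 + θ)⁻¹ * v := by positivity
  have hM : ∀ t : ℝ, 0 ≤ t →
      Real.exp (VaryingBranching.logMean lam a t) ≤ Real.exp (L * (1 + 1 / θ)) := fun t ht =>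
    Real.exp_le_exp.2 ((le_abs_self _).trans (hZ.abs_logMean_le hLle ht))
  obtain ⟨Zinf, hZm, hZlim⟩ := measurable_limit_of_tendsto_metrizable_ae
    (fun t => (hZ.measurable t).aemeasurable) (hZ.ae_eventually_constant hM hL)
  refine ⟨(Real.exp e).toNNReal, (θ * (1 + θ)⁻¹ * v).toNNReal,
    Real.toNNReal_pos.2 (Real.exp_pos e), hZ.tendsto_meanSize he, ?_, Zinf, hZm, hZlim, ?_⟩
  · exact (ENNReal.tendsto_ofReal (hv.const_mul _)).congr fun t => (hZ.thetaV_eq t).symm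
  intro s hs hs1
  rw [Real.coe_toNNReal _ (Real.exp_pos e).le, Real.coe_toNNReal _ hV0]
  -- Dominated convergence with bound one identifies the law of the limit.
  have h1 : Tendsto (fun t => ∫ ω, s ^ Z t ω ∂P) atTop (𝓝 (∫ ω, s ^ Zinf ω ∂P)) := by
    refine tendsto_integral_filter_of_dominated_convergence (fun _ => 1)
      (Eventually.of_forall fun t =>
        (VaryingBranching.integrable_pow_comp (hZ.measurable t) hs hs1.le).aestronglyMeasurable)
      (Eventually.of_forall fun t => Eventually.of_forall fun ω => ?_) (integrable_const 1) ?_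
    · rw [Real.norm_of_nonneg (pow_nonneg hs _)]
      exact pow_le_one₀ hs hs1.le
    · filter_upwards [hZlim] with ω hω
      exact (continuous_of_discreteTopology (f := fun n : ℕ => s ^ n)).tendsto _ |>.comp hω
  simp only [hZ.integral_pow _ hs hs1] at h1
  have hD := hZ.tendsto_bernoulliTerm he hv
  have hw := VaryingBranching.IsThetaPositive.tendsto_meanWeight (θ := θ) he
  have hC := hD.add (hw.mul_const ((1 - s) ^ (-θ)))
  have hone : (1 : ℝ) ≤ (1 - s) ^ (-θ) :=
    Real.one_le_rpow_of_pos_of_le_one_of_nonpos (by linarith) (by linarith) (by linarith)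
  -- The limiting base is at least one, so the power `-1/θ` is continuous there.
  have hpos := ge_of_tendsto' hC fun t => (hZ.one_le_bernoulliTerm_add t).trans
    (add_le_add le_rfl (le_mul_of_one_le_right
      (VaryingBranching.meanWeight_pos θ lam a t).le hone))
  exact tendsto_nhds_unique h1
    ((hC.rpow_const (Or.inl (one_pos.trans_le hpos).ne')).const_sub 1)
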